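/- Let $\hat{\mathbb C}=\mathbb C\cup\{\infty\}$. Let $R_0(w)$ be a complex polynomial of degree $d$ all of whose zeros are simple, and let $P(z,w)$ be a complex polynomial of total degree at most $d$, written (uniquely) as $$P(z,w)=\sum_{j=0}^{d}P_j(w)\,(w-z)^{d-j},\qquad \deg P_j\le j .$$ Assume that $P\not\equiv 0$ and that, for the minimal $j$ with $P_j\not\equiv 0$, one has $j<d$ and the polynomial $P_j$ is not constant. For $\delta\in\mathbb C$ put $R_\delta(z,w)=R_0(w)+\delta P(z,w)$, let $\Gamma_\delta$ be the closure in $\hat{\mathbb C}\times\hat{\mathbb C}$ of the curve $\{(z,w)\in\mathbb C^2: R_\delta(z,w)=0\}$, and let $F_\delta(z)=\{w:(z,w)\in\Gamma_\delta\}$ be the associated holomorphic correspondence $F_\delta:z\to w$. For $\delta$ of small absolute value $\deg_w R_\delta=d$ and every $F_\delta(z)$, $z\in\hat{\mathbb C}$, consists of $d$ points counted with multiplicity: for $z\in\mathbb C$ they are the zeros of $w\mapsto R_\delta(z,w)$, and for $z=\infty$ they are the zeros of the coefficient (a polynomial in $w$) of the highest power of $z$ in $R_\delta$, together with $\infty$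 taken as many times as is needed to make $d$ points in all. For a finite Borel measure $\nu$ on $\hat{\mathbb C}$ the push-forward $(F_\delta)_*\nu$ is the measure $B\mapsto\int \#\big(F_\delta(z)\cap B\big)\,d\nu(z)$, with points counted with multiplicity, so that $(F_\delta)_*\delta_a=\sum_{w\in F_\delta(a)}\delta_w$, where $\delta_x$ denotes the Dirac measure at $x$; $(F_\delta^m)_*$ is the push-forward by the $m$-fold composition of $F_\delta$. Then for every $\epsilon>0$ there is $\Delta>0$ such that for every $\delta\in\mathbb C$ with $|\delta|<\Delta$ there is a regular Borel probability measure $\mu_{F_\delta}$ on $\hat{\mathbb C}$ with the following properties: 1. $(F_\delta)_*\mu_{F_\delta}=d\,\mu_{F_\delta}$; 2. for every $a\in\hat{\mathbb C}$, including $a=\infty$, $\ d^{-m}(F_\delta^m)_*\delta_a\to\mu_{F_\delta}$ in the weak-* topology as $m\to\infty$; 3. $\operatorname{supp}\mu_{F_\delta}$ is contained in the $\epsilon$-neighborhood (in $\mathbb C$) of the set of zeros of $R_0$; 4. $\operatorname{supp}\mu_{F_\delta}$ is the minimal closed forward invariant set: it is non-empty, closed and forward invariant under $F_\delta$ (a set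 $S$ is forward invariant if $F_\delta(S)\subset S$), and it is contained in every non-empty closed forward invariant subset of $\hat{\mathbb C}$. -/

import Mathlib

open MeasureTheory Filter Topology

noncomputable section

namespace HolCorr

/-- The Riemann sphere, as the one-point compactification of the complex plane. -/
abbrev Sphere : Type := OnePoint ℂ

/-- The Borel sigma-algebra of the Riemann sphere. -/
instance instMeasurableSpaceSphere : MeasurableSpace Sphere := borel Sphere

instance instBorelSpaceSphere : BorelSpace Sphere := ⟨rfl⟩

/-! Bivariate polynomials are elements of `MvPolynomial (Fin 2) ℂ`; the variable `0` is `z` and the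
variable `1` is `w`. -/

/-- The algebraic curve on `Sphere × Sphere` defined by `R(z, w)`: the closure of the affine curve
`R(z, w) = 0`. -/
def curve (R : MvPolynomial (Fin 2) ℂ) : Set (Sphere × Sphere) :=
  closure {p | ∃ z w : ℂ, MvPolynomial.eval ![z, w] R = 0 ∧ p = ((z : Sphere), (w : Sphere))}

/-- The multivalued map `F : z → w` of the correspondence defined by `R`, as a set-valued map. -/
def image (R : MvPolynomial (Fin 2) ℂ) (a : Sphere) : Set Sphere :=
  {b | (a, b) ∈ curve R}

/-- `S` is forward invariant: `F(S) ⊆ S`. -/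
def ForwardInvariant (R : MvPolynomial (Fin 2) ℂ) (S : Set Sphere) : Prop :=
  ∀ a ∈ S, image R a ⊆ S

/-- The equation, in `w`, of the intersection of the curve with the line `z = a`. For finite `a` it
is `R(a, w)`; for `a = ∞` it is the coefficient in `ℂ[w]` of the highest power of `z` in `R`. -/
def fibre (R : MvPolynomial (Fin 2) ℂ) : Sphere → Polynomial ℂ
  | OnePoint.infty =>
      (MvPolynomial.aeval ![Polynomial.X, Polynomial.C Polynomial.X] R :
        Polynomial (Polynomial ℂ)).leadingCoeff
  | OnePoint.some a => MvPolynomial.aeval ![Polynomial.C a, Polynomial.X] R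

/-- The points of `F(a)` counted with multiplicity, for a curve that does not contain the line
`z = a` (that is, `fibre R a ≠ 0`): the zeros of the fibre polynomial with their multiplicities, and
the point `∞` with multiplicity `deg_w R - deg (fibre R a)`. There are `deg_w R` of them. -/
def images (R : MvPolynomial (Fin 2) ℂ) (a : Sphere) : Multiset Sphere :=
  (fibre R a).roots.map (fun w : ℂ => (w : Sphere)) +
    Multiset.replicate (MvPolynomial.degreeOf 1 R - (fibre R a).natDegree) OnePoint.infty

/-- The `m`-fold composition `F^m` of a correspondence, given by its images with multiplicity. -/
def iter (F : Sphere → Multiset Sphere) : ℕ → Sphere → Multiset Sphere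
  | 0, a => {a}
  | m + 1, a => (iter F m a).bind F

/-- The sum of the Dirac measures at the points of a finite multiset. -/
def diracSum (s : Multiset Sphere) : Measure Sphere :=
  (s.map Measure.dirac).sum

/-- The push-forward `F_* μ` of a measure `μ` by a correspondence `F` given by its images with
multiplicity: `(F_* μ)(B) = ∫ #(F(a) ∩ B) dμ(a)`, so that `F_* δ_a` is the sum of the Dirac measures
at the points of `F(a)`. -/
def pushforward (F : Sphere → Multiset Sphere) (μ : Measure Sphere) : Measure Sphere :=
  μ.bind (fun a => diracSum (F a))

/-- `R_δ(z, w) = R₀(w) + δ P(z, w)`. -/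
def perturb (R₀ : Polynomial ℂ) (P : MvPolynomial (Fin 2) ℂ) (δ : ℂ) : MvPolynomial (Fin 2) ℂ :=
  Polynomial.aeval (MvPolynomial.X 1) R₀ + MvPolynomial.C δ * P

/-- Weak-* convergence of a sequence of measures on the sphere, tested on `C(Sphere, ℂ)`. -/
def WeakStarTendsto (ν : ℕ → Measure Sphere) (μ : Measure Sphere) : Prop :=
  ∀ φ : C(Sphere, ℂ), Tendsto (fun m => ∫ x, φ x ∂(ν m)) atTop (𝓝 (∫ x, φ x ∂μ))

end HolCorr

end

/-! At δ = 0 the image of every point is the set of the d distinct zeros of R₀. For small δ and z in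
a fixed closed disc, the d roots of R_δ(z, ·) stay one near each of these zeros and depend on z with
Lipschitz constant 1/2 (`exists_branches`), so over the disc the correspondence is an iterated
function system of d contractions. Averaging a continuous function over the branches repeatedly
drives its oscillation to 0. This yields an invariant probability measure and uniform convergence of
the iterated averages to the integral (`exists_averageMeasure_eq`,
`iterate_average_tendsto_integral`).

To reach the whole sphere it suffices that every point has at least one image in the disc. The disc
is mapped into itself, so after m steps the proportion of images outside it is at most (1 - 1/d)^m
(`norm_iterate_mean_sub_le`, `tendsto_iterate_mean`). For z = ∞ and δ ≠ 0 such an image is a zero of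
Q_j, which exists because Q_j is not constant. For large finite z the quantity |δ||z|^(d-j) can have
any size, and `exists_small_root_of_le_norm` compares coefficients. If all roots were far away, the
constant coefficient would dominate; but the leading coefficient stays bounded below, and a
nonconstant coefficient supplied by Q_j grows as fast as the constant one can.

For minimality (`exists_equilibriumMeasure`), a function that vanishes on a closed forward invariant
set has zero averages along an orbit starting there, hence zero integral. This forces the support
into the set. -/

noncomputable section

namespace HolCorr

/-! ### Averaging over a finite family of contractions of a compact space -/

section IteratedFunctionSystem

variable {ι X E : Type*} [Fintype ι] [NormedAddCommGroup E] [NormedSpace ℝ E]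

/-- The averaging operator of a finite family of self-maps, acting on functions. -/
def average (f : ι → X → X) (φ : X → E) (x : X) : E :=
  (Fintype.card ι : ℝ)⁻¹ • ∑ i, φ (f i x)

variable [Nonempty ι] in
lemma average_sub_const_norm_le (f : ι → X → X) (φ : X → E) (c : E) (r : ℝ) (x : X)
    (h : ∀ i, ‖φ (f i x) - c‖ ≤ r) : ‖average f φ x - c‖ ≤ r := by
  have hc : (0 : ℝ) < Fintype.card ι := by exact_mod_cast Fintype.card_pos
  have : average f φ x - c = (Fintype.card ι : ℝ)⁻¹ • ∑ i, (φ (f i x) - c) := by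
    rw [average, Finset.sum_sub_distrib, smul_sub, Finset.sum_const, Finset.card_univ,
      ← Nat.cast_smul_eq_nsmul ℝ, smul_smul, inv_mul_cancel₀ hc.ne', one_smul]
  rw [this, norm_smul, norm_inv, Real.norm_natCast, inv_mul_le_iff₀ hc]
  calc ‖∑ i, (φ (f i x) - c)‖ ≤ ∑ i : ι, r := norm_sum_le_of_le _ fun i _ => h i
    _ = _ := by simp

variable [Nonempty ι] in
lemma iterate_average_sub_const_norm_le (f : ι → X → X) (n : ℕ) (φ : X → E) (c : E) (r : ℝ)
    (h : ∀ y, ‖φ y - c‖ ≤ r) (x : X) : ‖(average f)^[n] φ x - c‖ ≤ r := by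
  induction n generalizing x with
  | zero => exact h x
  | succ n ih =>
    rw [Function.iterate_succ_apply']
    exact average_sub_const_norm_le f _ c r x fun i => ih _

variable [Nonempty ι] in
lemma average_sub_norm_le (f : ι → X → X) (φ : X → E) (r : ℝ) (x y : X)
    (h : ∀ i, ‖φ (f i x) - φ (f i y)‖ ≤ r) : ‖average f φ x - average f φ y‖ ≤ r := by
  have hc : (0 : ℝ) < Fintype.card ι := by exact_mod_cast Fintype.card_pos
  rw [average, average, ← smul_sub, ← Finset.sum_sub_distrib, norm_smul, norm_inv,
    Real.norm_natCast, inv_mul_le_iff₀ hc]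
  calc ‖∑ i, (φ (f i x) - φ (f i y))‖ ≤ ∑ i : ι, r := norm_sum_le_of_le _ fun i _ => h i
    _ = _ := by simp

lemma continuous_average [TopologicalSpace X] {f : ι → X → X} (hf : ∀ i, Continuous (f i))
    {φ : X → E} (hφ : Continuous φ) : Continuous (average f φ) :=
  (continuous_finsetSum _ fun i _ => hφ.comp (hf i)).const_smul _

lemma continuous_iterate_average [TopologicalSpace X] {f : ι → X → X}
    (hf : ∀ i, Continuous (f i)) {φ : X → E} (hφ : Continuous φ) (n : ℕ) :
    Continuous ((average f)^[n] φ) := by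
  induction n with
  | zero => exact hφ
  | succ n ih =>
    rw [Function.iterate_succ_apply']
    exact continuous_average hf ih

variable [Nonempty ι] in
lemma iterate_average_oscillation [PseudoMetricSpace X] [CompactSpace X] {f : ι → X → X}
    (hf : ∀ i x y, dist (f i x) (f i y) ≤ 2⁻¹ * dist x y) {φ : X → E} (hφ : Continuous φ)
    {ε : ℝ} (hε : 0 < ε) :
    ∃ N, ∀ n ≥ N, ∀ x y, ‖(average f)^[n] φ x - (average f)^[n] φ y‖ ≤ ε := by
  obtain ⟨η, hη, h⟩ := Metric.uniformContinuous_iff.1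
    (CompactSpace.uniformContinuous_of_continuous hφ) ε hε
  -- Each averaging step doubles the scale on which the oscillation is at most ε; the scale
  -- eventually exceeds the diameter.
  have key : ∀ n : ℕ, ∀ x y, dist x y < 2 ^ n * η →
      ‖(average f)^[n] φ x - (average f)^[n] φ y‖ ≤ ε := by
    intro n
    induction n with
    | zero =>
      intro x y hxy
      rw [← dist_eq_norm]
      exact (h (by simpa using hxy)).le
    | succ n ih =>
      intro x y hxy
      rw [Function.iterate_succ_apply']
      refine average_sub_norm_le f _ ε x y fun i => ih _ _ ?_
      have := hf i x y
      rw [pow_succ] at hxy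
      linarith
  obtain ⟨D, hD⟩ := (Metric.isBounded_iff.1 (isCompact_univ (X := X)).isBounded)
  obtain ⟨N, hN⟩ := pow_unbounded_of_one_lt (D / η) (one_lt_two (α := ℝ))
  refine ⟨N, fun n hn x y => key n x y ?_⟩
  refine (hD (Set.mem_univ x) (Set.mem_univ y)).trans_lt ?_
  rw [← div_lt_iff₀ hη]
  exact hN.trans_le (pow_le_pow_right₀ one_le_two hn)

section Measure

variable [MeasurableSpace X] [TopologicalSpace X] [BorelSpace X]

/-- The averaging operator of a finite family of self-maps, acting on measures. -/
def averageMeasure (f : ι → X → X) (μ : Measure X) : Measure X :=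
  (Fintype.card ι : ENNReal)⁻¹ • ∑ i, μ.map (f i)

variable [Nonempty ι] in
lemma isProbabilityMeasure_averageMeasure {f : ι → X → X} (hf : ∀ i, Continuous (f i))
    (μ : Measure X) [IsProbabilityMeasure μ] : IsProbabilityMeasure (averageMeasure f μ) := by
  constructor
  have h : ∀ i, μ.map (f i) Set.univ = 1 := fun i => by
    rw [Measure.map_apply (hf i).measurable MeasurableSet.univ]; simp
  rw [averageMeasure, Measure.smul_apply, Measure.finsetSum_apply]
  simp only [h, Finset.sum_const, Finset.card_univ, nsmul_eq_mul, mul_one, smul_eq_mul]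
  exact ENNReal.inv_mul_cancel (by simp) (by simp)

lemma integral_averageMeasure [CompactSpace X] {f : ι → X → X} (hf : ∀ i, Continuous (f i))
    (μ : Measure X) [IsFiniteMeasure μ] [SecondCountableTopology E]
    {φ : X → E} (hφ : Continuous φ) :
    ∫ x, φ x ∂(averageMeasure f μ) = ∫ x, average f φ x ∂μ := by
  have hint : ∀ (ν : Measure X) [IsFiniteMeasure ν] {ψ : X → E}, Continuous ψ →
      Integrable ψ ν := fun ν _ ψ hψ =>
    hψ.integrable_of_hasCompactSupport (HasCompactSupport.of_compactSpace ψ)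
  rw [averageMeasure, integral_smul_measure,
    integral_finsetSum_measure fun i _ => hint _ hφ]
  simp only [average]
  rw [integral_smul, integral_finsetSum (f := fun i x => φ (f i x)) _
    fun i _ => hint μ (hφ.comp (hf i))]
  congr 1
  · simp
  · refine Finset.sum_congr rfl fun i _ => ?_
    rw [integral_map (hf i).measurable.aemeasurable]
    exact hφ.aestronglyMeasurable

end Measure

variable [Nonempty ι] [MeasurableSpace X] [MetricSpace X] [CompactSpace X] [BorelSpace X]

/-- A finite family of contractions of a compact metric space has an invariant probability
measure. -/
theorem exists_averageMeasure_eq [Nonempty X] {f : ι → X → X}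
    (hf : ∀ i x y, dist (f i x) (f i y) ≤ 2⁻¹ * dist x y) :
    ∃ μ : Measure X, IsProbabilityMeasure μ ∧ averageMeasure f μ = μ := by
  have hc : ∀ i, Continuous (f i) := fun i =>
    (LipschitzWith.of_dist_le_mul (K := 2⁻¹) (by simpa using hf i)).continuous
  obtain ⟨x₀⟩ := ‹Nonempty X›
  let step : ProbabilityMeasure X → ProbabilityMeasure X := fun ν =>
    ⟨averageMeasure f ν, isProbabilityMeasure_averageMeasure hc _⟩
  let ν : ℕ → ProbabilityMeasure X := fun n => step^[n] ⟨Measure.dirac x₀, inferInstance⟩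
  have hν : ∀ n {φ : X → ℝ}, Continuous φ →
      ∫ x, φ x ∂(ν n : Measure X) = (average f)^[n] φ x₀ := by
    intro n
    induction n with
    | zero =>
      intro φ hφ
      exact integral_dirac _ _
    | succ n ih =>
      intro φ hφ
      have : (ν (n + 1) : Measure X) = averageMeasure f (ν n : Measure X) :=
        congrArg (fun p : ProbabilityMeasure X => (p : Measure X))
          (Function.iterate_succ_apply' step n _)
      rw [this, integral_averageMeasure hc _ hφ, ih (continuous_average hc hφ),
        Function.iterate_succ_apply]
  -- By compactness of the space of probability measures, ν converges along a free ultrafilter; this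
  -- replaces the extraction of a subsequence.
  let U : Ultrafilter ℕ := hyperfilter ℕ
  have hU : (U : Filter ℕ) ≤ atTop := Nat.hyperfilter_le_atTop
  obtain ⟨μ, -, hμ⟩ := isCompact_iff_ultrafilter_le_nhds.1 (isCompact_univ)
    (U.map ν) (by simp)
  have hlim : ∀ {φ : X → ℝ}, Continuous φ →
      Tendsto (fun n => (average f)^[n] φ x₀) U (𝓝 (∫ x, φ x ∂(μ : Measure X))) := by
    intro φ hφ
    have h := (ProbabilityMeasure.tendsto_iff_forall_integral_tendsto.1
      (show Tendsto ν U (𝓝 μ) from hμ)) (BoundedContinuousFunction.mkOfCompact ⟨φ, hφ⟩)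
    simpa [hν _ hφ] using h
  have := isProbabilityMeasure_averageMeasure hc (μ : Measure X)
  refine ⟨μ, inferInstance, ext_of_forall_integral_eq_of_IsFiniteMeasure fun φ => ?_⟩
  rw [integral_averageMeasure hc _ φ.continuous]
  refine tendsto_nhds_unique (hlim (continuous_average hc φ.continuous)) ?_
  -- Replacing φ by its average only shifts the sequence by one step, which costs at most the
  -- oscillation of the n-th iterate.
  have hdiff : Tendsto (fun n => (average f)^[n] (average f φ) x₀ - (average f)^[n] φ x₀)
      atTop (𝓝 0) := by
    rw [Metric.tendsto_atTop]
    intro ε hε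
    obtain ⟨N, hN⟩ := iterate_average_oscillation hf φ.continuous (half_pos hε)
    refine ⟨N, fun n hn => ?_⟩
    rw [dist_zero_right, ← Function.iterate_succ_apply, Function.iterate_succ_apply']
    exact (average_sub_const_norm_le f _ _ _ _ fun i => hN n hn _ _).trans_lt (half_lt_self hε)
  simpa using (hdiff.mono_left hU).add (hlim φ.continuous)

/-- By invariance, the integral of φ is also that of its n-th iterate, so the distance to it is
bounded by the oscillation of that iterate, uniformly in x. -/
lemma iterate_average_tendsto_integral [SecondCountableTopology E] [CompleteSpace E]
    {f : ι → X → X} (hf : ∀ i x y, dist (f i x) (f i y) ≤ 2⁻¹ * dist x y)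
    {μ : Measure X} [IsProbabilityMeasure μ] (hμ : averageMeasure f μ = μ)
    {φ : X → E} (hφ : Continuous φ) {ε : ℝ} (hε : 0 < ε) :
    ∃ N, ∀ n ≥ N, ∀ x, ‖(average f)^[n] φ x - ∫ y, φ y ∂μ‖ ≤ ε := by
  have hc : ∀ i, Continuous (f i) := fun i =>
    (LipschitzWith.of_dist_le_mul (K := 2⁻¹) (by simpa using hf i)).continuous
  have hinv : ∀ n, ∫ y, φ y ∂μ = ∫ y, (average f)^[n] φ y ∂μ := by
    intro n
    induction n with
    | zero => rfl
    | succ n ih =>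
      rw [ih, Function.iterate_succ_apply',
        ← integral_averageMeasure hc μ (continuous_iterate_average hc hφ n), hμ]
  obtain ⟨N, hN⟩ := iterate_average_oscillation hf hφ hε
  refine ⟨N, fun n hn x => ?_⟩
  have hint : Integrable ((average f)^[n] φ) μ :=
    (continuous_iterate_average hc hφ n).integrable_of_hasCompactSupport
      (HasCompactSupport.of_compactSpace _)
  rw [hinv n]
  calc ‖(average f)^[n] φ x - ∫ y, (average f)^[n] φ y ∂μ‖
      = ‖∫ y, ((average f)^[n] φ x - (average f)^[n] φ y) ∂μ‖ := by
        rw [integral_sub (integrable_const _) hint]; simp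
    _ ≤ ε * μ.real Set.univ := norm_integral_le_of_norm_le_const (ae_of_all _ (hN n hn x))
    _ = ε := by simp

end IteratedFunctionSystem

/-! ### Supports of invariant measures -/

section InvariantSupport

variable {ι X : Type*} [Fintype ι] [MeasurableSpace X] [TopologicalSpace X] [BorelSpace X]

lemma averageMeasure_apply {f : ι → X → X} (hf : ∀ i, Continuous (f i)) (μ : Measure X)
    {s : Set X} (hs : MeasurableSet s) :
    averageMeasure f μ s = (Fintype.card ι : ENNReal)⁻¹ * ∑ i, μ (f i ⁻¹' s) := by
  rw [averageMeasure, Measure.smul_apply, Measure.finsetSum_apply, smul_eq_mul]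
  congr 1
  exact Finset.sum_congr rfl fun i _ => Measure.map_apply (hf i).measurable hs

/-- The preimage under one branch of an open neighbourhood of `f i x` is a neighbourhood of `x`, and
its positive mass is one summand of the invariance equation. -/
lemma apply_mem_support_of_averageMeasure_eq {f : ι → X → X} (hf : ∀ i, Continuous (f i))
    {μ : Measure X} (hμ : averageMeasure f μ = μ) {x : X} (hx : x ∈ μ.support) (i : ι) :
    f i x ∈ μ.support := by
  rw [Measure.mem_support_iff_forall] at hx ⊢
  intro V hV
  obtain ⟨W, hWV, hW, hxW⟩ := mem_nhds_iff.1 hV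
  refine lt_of_lt_of_le ?_ (measure_mono hWV)
  rw [← hμ, averageMeasure_apply hf μ hW.measurableSet]
  refine ENNReal.mul_pos (by simp) (ne_of_gt ?_)
  exact (hx _ ((hW.preimage (hf i)).mem_nhds hxW)).trans_le
    (Finset.single_le_sum (f := fun i => μ (f i ⁻¹' W)) (fun _ _ => zero_le)
      (Finset.mem_univ i))

lemma support_subset_of_averageMeasure_eq {f : ι → X → X} (hf : ∀ i, Continuous (f i))
    {μ : Measure X} (hμ : averageMeasure f μ = μ) {C : Set X} (hC : IsClosed C)
    (h : ∀ i x, f i x ∈ C) : μ.support ⊆ C := by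
  refine Measure.support_subset_of_isClosed hC ?_
  rw [mem_ae_iff, ← hμ, averageMeasure_apply hf μ hC.isOpen_compl.measurableSet]
  have : ∀ i, f i ⁻¹' Cᶜ = ∅ := fun i => by ext x; simp [h i x]
  simp [this]

/-- If a point of the support were outside `C`, a Urysohn function that is 0 on `C` and 1 at the
point would have positive integral. -/
lemma support_subset_of_forall_integral_eq_zero [CompactSpace X] [T2Space X] {μ : Measure X}
    [IsFiniteMeasure μ] {C : Set X} (hC : IsClosed C)
    (h : ∀ φ : C(X, ℝ), (∀ x ∈ C, φ x = 0) → ∫ x, φ x ∂μ = 0) : μ.support ⊆ C := by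
  intro x hx
  by_contra hxC
  obtain ⟨φ, h0, h1, hφ⟩ := exists_continuous_zero_one_of_isClosed hC (isClosed_singleton (x := x))
    (Set.disjoint_singleton_right.2 hxC)
  have hint : Integrable φ μ :=
    φ.continuous.integrable_of_hasCompactSupport (HasCompactSupport.of_compactSpace _)
  have hae := (integral_eq_zero_iff_of_nonneg (fun y => (hφ y).1) hint).1 (h φ fun y hy => h0 hy)
  have hV : {y | φ y ≠ 0} ∈ 𝓝 x :=
    (isOpen_ne.preimage φ.continuous).mem_nhds (by simp [h1 rfl])
  exact (((Measure.mem_support_iff_forall x).1 hx) _ hV).ne' hae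

lemma support_map_of_isClosedEmbedding {Y : Type*} [TopologicalSpace Y] [MeasurableSpace Y]
    [BorelSpace Y] {e : X → Y} (he : IsClosedEmbedding e) (μ : Measure X) :
    (μ.map e).support = e '' μ.support := by
  have hm := he.measurableEmbedding
  ext y
  constructor
  · intro hy
    rw [Measure.mem_support_iff_forall] at hy
    by_cases hr : y ∈ Set.range e
    · obtain ⟨x, rfl⟩ := hr
      refine ⟨x, (Measure.mem_support_iff_forall x).2 fun V hV => ?_, rfl⟩
      rw [he.isInducing.nhds_eq_comap] at hV
      obtain ⟨W, hW, hWV⟩ := hV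
      have := hy W hW
      rw [hm.map_apply] at this
      exact this.trans_le (measure_mono hWV)
    · have := hy _ (he.isClosed_range.isOpen_compl.mem_nhds hr)
      simp [hm.map_apply] at this
  · rintro ⟨x, hx, rfl⟩
    rw [Measure.mem_support_iff_forall] at hx ⊢
    intro V hV
    rw [hm.map_apply]
    exact hx _ (he.continuous.continuousAt.preimage_mem_nhds hV)

end InvariantSupport

/-! ### The averaging operator of a multivalued map -/

section Transfer

variable {E : Type*} [NormedAddCommGroup E] [NormedSpace ℝ E]

/-- The normalized sum of the values of a function on the points of `F(a)`. -/
def mean (d : ℕ) (F : Sphere → Multiset Sphere) (φ : Sphere → E) (a : Sphere) : E :=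
  (d : ℝ)⁻¹ • ((F a).map φ).sum

/-- This is the duality between iterating the correspondence on points and iterating `mean` on
functions. -/
lemma sum_map_iter (d : ℕ) (F : Sphere → Multiset Sphere) (n : ℕ) (φ : Sphere → E) (a : Sphere) :
    ((d : ℝ) ^ n)⁻¹ • ((iter F n a).map φ).sum = (mean d F)^[n] φ a := by
  induction n generalizing φ with
  | zero => simp [iter]
  | succ n ih =>
    rw [Function.iterate_succ_apply, ← ih, iter, Multiset.map_bind, Multiset.sum_bind,
      pow_succ, mul_inv, mul_smul]
    congr 1
    rw [Multiset.smul_sum, Multiset.map_map]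
    rfl

lemma iterate_mean_eq_zero_of_forall_mem (d : ℕ) {F : Sphere → Multiset Sphere} {S : Set Sphere}
    (hS : ∀ a ∈ S, ∀ b ∈ F a, b ∈ S) {φ : Sphere → E} (hφ : ∀ a ∈ S, φ a = 0) (n : ℕ) :
    ∀ a ∈ S, (mean d F)^[n] φ a = 0 := by
  induction n with
  | zero => exact hφ
  | succ n ih =>
    intro a ha
    rw [Function.iterate_succ_apply', mean, Multiset.sum_eq_zero, smul_zero]
    intro y hy
    obtain ⟨b, hb, rfl⟩ := Multiset.mem_map.1 hy
    exact ih b (hS a ha b hb)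

lemma diracSum_cons (a : Sphere) (s : Multiset Sphere) :
    diracSum (a ::ₘ s) = Measure.dirac a + diracSum s := by
  simp [diracSum]

lemma isFiniteMeasure_diracSum (s : Multiset Sphere) : IsFiniteMeasure (diracSum s) := by
  induction s using Multiset.induction_on with
  | empty => simpa [diracSum] using (inferInstance : IsFiniteMeasure (0 : Measure Sphere))
  | cons a s ih => rw [diracSum_cons]; infer_instance

lemma integral_diracSum [SecondCountableTopology E] [CompleteSpace E] (s : Multiset Sphere)
    {φ : Sphere → E} (hφ : Continuous φ) : ∫ x, φ x ∂(diracSum s) = (s.map φ).sum := by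
  induction s using Multiset.induction_on with
  | empty => simp [diracSum]
  | cons a s ih =>
    have := isFiniteMeasure_diracSum s
    rw [diracSum_cons, integral_add_measure, ih, integral_dirac, Multiset.map_cons,
      Multiset.sum_cons] <;>
    exact hφ.integrable_of_hasCompactSupport (HasCompactSupport.of_compactSpace _)

/-- No measurability of `F` is needed: with respect to the Dirac measure the integrand is almost
everywhere constant. -/
lemma pushforward_dirac (F : Sphere → Multiset Sphere) (a : Sphere) :
    pushforward F (Measure.dirac a) = diracSum (F a) := by
  have h : (fun b => diracSum (F b)) =ᵐ[Measure.dirac a] fun _ => diracSum (F a) := by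
    rw [EventuallyEq, ae_dirac_eq]; rfl
  rw [pushforward, Measure.bind_congr_right h, Measure.bind_const]
  simp

lemma integral_pushforward_iter_dirac [SecondCountableTopology E] [CompleteSpace E] (d : ℕ)
    (F : Sphere → Multiset Sphere) (n : ℕ) (a : Sphere) {φ : Sphere → E} (hφ : Continuous φ) :
    ∫ x, φ x ∂(((d : ENNReal) ^ n)⁻¹ • pushforward (iter F n) (Measure.dirac a)) =
      (mean d F)^[n] φ a := by
  rw [pushforward_dirac, integral_smul_measure, integral_diracSum _ hφ, ← sum_map_iter]
  simp

end Transfer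

/-! ### From contractions on a disc to convergence on the sphere -/

section Dynamics

variable {ι : Type*} [Fintype ι] {ρ : ℝ} {E : Type*} [NormedAddCommGroup E] [NormedSpace ℝ E]

/-- The inclusion of a closed disc in the Riemann sphere. -/
def discIncl (ρ : ℝ) (x : Metric.closedBall (0 : ℂ) ρ) : Sphere := ((x : ℂ) : Sphere)

lemma isClosedEmbedding_discIncl (ρ : ℝ) : IsClosedEmbedding (discIncl ρ) := by
  have : CompactSpace (Metric.closedBall (0 : ℂ) ρ) :=
    isCompact_iff_compactSpace.1 (isCompact_closedBall _ _)
  refine Continuous.isClosedEmbedding ?_ ?_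
  · exact OnePoint.continuous_coe.comp continuous_subtype_val
  · exact OnePoint.coe_injective.comp Subtype.val_injective

variable {F : Sphere → Multiset Sphere}
  {f : ι → Metric.closedBall (0 : ℂ) ρ → Metric.closedBall (0 : ℂ) ρ}

lemma norm_sum_map_sub_le (χ : Sphere → E) (c : E) (B : ℝ) (h : ∀ b, ‖χ b - c‖ ≤ B)
    (t : Multiset Sphere) : ‖(t.map χ).sum - (t.card : ℝ) • c‖ ≤ t.card * B := by
  induction t using Multiset.induction_on with
  | empty => simp
  | cons b t iht =>
    rw [Multiset.map_cons, Multiset.sum_cons, Multiset.card_cons]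
    push_cast
    calc _ = ‖(χ b - c) + ((t.map χ).sum - (t.card : ℝ) • c)‖ := by
          congr 1; rw [add_smul, one_smul]; abel
      _ ≤ B + t.card * B := (norm_add_le _ _).trans (add_le_add (h b) iht)
      _ = _ := by ring

lemma iterate_mean_discIncl
    (hF : ∀ x, F (discIncl ρ x) = Finset.univ.val.map fun i => discIncl ρ (f i x))
    (φ : Sphere → E) (n : ℕ) (x : Metric.closedBall (0 : ℂ) ρ) :
    (mean (Fintype.card ι) F)^[n] φ (discIncl ρ x) =
      (average f)^[n] (φ ∘ discIncl ρ) x := by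
  induction n generalizing x with
  | zero => rfl
  | succ n ih =>
    rw [Function.iterate_succ_apply', Function.iterate_succ_apply', mean, average, hF,
      Multiset.map_map]
    congr 1
    simp only [Function.comp_def, ih]
    rfl

/-- Among the d images of `a`, one lies in the disc and has error at most ε; the other d - 1 obey
the inductive bound. Averaging multiplies the excess over ε by 1 - 1/d. -/
lemma norm_iterate_mean_sub_le [Nonempty ι]
    (hF : ∀ x, F (discIncl ρ x) = Finset.univ.val.map fun i => discIncl ρ (f i x))
    (hcard : ∀ a, (F a).card = Fintype.card ι) (hret : ∀ a, ∃ x, discIncl ρ x ∈ F a)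
    {ψ : Sphere → E} {c : E} {C ε : ℝ} (hC : ∀ b, ‖ψ b - c‖ ≤ C)
    (hε : ∀ x, ‖ψ (discIncl ρ x) - c‖ ≤ ε) (hε0 : 0 ≤ ε) (n : ℕ) (a : Sphere) :
    ‖(mean (Fintype.card ι) F)^[n] ψ a - c‖ ≤
      ε + (1 - (Fintype.card ι : ℝ)⁻¹) ^ n * C := by
  have hd : (0 : ℝ) < Fintype.card ι := by exact_mod_cast Fintype.card_pos
  induction n generalizing a with
  | zero => simpa using (hC a).trans (le_add_of_nonneg_left hε0)
  | succ n ih =>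
    rw [Function.iterate_succ_apply']
    set χ := (mean (Fintype.card ι) F)^[n] ψ
    obtain ⟨x, hx⟩ := hret a
    obtain ⟨s, hs⟩ := Multiset.exists_cons_of_mem hx
    have hxε : ‖χ (discIncl ρ x) - c‖ ≤ ε := by
      simp only [χ]
      rw [iterate_mean_discIncl hF]
      exact iterate_average_sub_const_norm_le f n _ c ε hε x
    have hsc : (s.card : ℝ) = Fintype.card ι - 1 := by
      have := hcard a
      rw [hs, Multiset.card_cons] at this
      rw [← this]; push_cast; ring
    set B := ε + (1 - (Fintype.card ι : ℝ)⁻¹) ^ n * C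
    have hsum := norm_sum_map_sub_le χ c B ih s
    have hmain : mean (Fintype.card ι) F χ a - c = (Fintype.card ι : ℝ)⁻¹ •
        ((χ (discIncl ρ x) - c) + ((s.map χ).sum - (s.card : ℝ) • c)) := by
      rw [mean, hs, Multiset.map_cons, Multiset.sum_cons, hsc]
      rw [show χ (discIncl ρ x) - c + ((s.map χ).sum - ((Fintype.card ι : ℝ) - 1) • c) =
        (χ (discIncl ρ x) + (s.map χ).sum) - (Fintype.card ι : ℝ) • c by
          rw [sub_smul, one_smul]; abel]
      rw [smul_sub, smul_smul, inv_mul_cancel₀ hd.ne', one_smul]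
    rw [hmain, norm_smul, norm_inv, Real.norm_natCast, inv_mul_le_iff₀ hd]
    calc _ ≤ ε + s.card * B := (norm_add_le _ _).trans (add_le_add hxε hsum)
      _ = _ := by
        have hq : (s.card : ℝ) = Fintype.card ι * (1 - (Fintype.card ι : ℝ)⁻¹) := by
          rw [hsc, mul_sub, mul_one, mul_inv_cancel₀ hd.ne']
        have hε' : ε + s.card * ε = Fintype.card ι * ε := by rw [hsc]; ring
        rw [mul_add, ← add_assoc, hε', mul_add, hq, pow_succ]
        ring

lemma tendsto_iterate_mean [Nonempty ι] [SecondCountableTopology E] [CompleteSpace E]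
    (hf : ∀ i x y, dist (f i x) (f i y) ≤ 2⁻¹ * dist x y)
    (hF : ∀ x, F (discIncl ρ x) = Finset.univ.val.map fun i => discIncl ρ (f i x))
    (hcard : ∀ a, (F a).card = Fintype.card ι) (hret : ∀ a, ∃ x, discIncl ρ x ∈ F a)
    {μ : Measure (Metric.closedBall (0 : ℂ) ρ)} [IsProbabilityMeasure μ]
    (hμ : averageMeasure f μ = μ) {φ : Sphere → E} (hφ : Continuous φ) (a : Sphere) :
    Tendsto (fun n => (mean (Fintype.card ι) F)^[n] φ a) atTop
      (𝓝 (∫ y, φ y ∂(μ.map (discIncl ρ)))) := by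
  have : CompactSpace (Metric.closedBall (0 : ℂ) ρ) :=
    isCompact_iff_compactSpace.1 (isCompact_closedBall _ _)
  have hd : (1 : ℝ) ≤ Fintype.card ι := by exact_mod_cast Fintype.card_pos (α := ι)
  have he := isClosedEmbedding_discIncl ρ
  rw [he.measurableEmbedding.integral_map]
  set c := ∫ x, φ (discIncl ρ x) ∂μ
  obtain ⟨C, hC⟩ : ∃ C, ∀ b, ‖φ b - c‖ ≤ C := by
    obtain ⟨C, hC⟩ := isCompact_univ.exists_bound_of_continuousOn
      ((hφ.sub continuous_const).continuousOn (s := Set.univ))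
    exact ⟨C, fun b => hC b trivial⟩
  have hC0 : 0 ≤ C := (norm_nonneg _).trans (hC a)
  have hq0 : 0 ≤ 1 - (Fintype.card ι : ℝ)⁻¹ := by
    rw [sub_nonneg]; exact inv_le_one_of_one_le₀ hd
  have hq1 : 1 - (Fintype.card ι : ℝ)⁻¹ < 1 := by
    have : 0 < (Fintype.card ι : ℝ)⁻¹ := by positivity
    linarith
  have hbound : ∀ n b, ‖(mean (Fintype.card ι) F)^[n] φ b - c‖ ≤ C := by
    intro n
    induction n with
    | zero => exact hC
    | succ n ih =>
      intro b
      rw [Function.iterate_succ_apply']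
      have hs := norm_sum_map_sub_le _ c C ih (F b)
      rw [hcard] at hs
      rw [mean, ← inv_smul_smul₀ (zero_lt_one.trans_le hd).ne' c, ← smul_sub, norm_smul, norm_inv,
        Real.norm_natCast, inv_mul_le_iff₀ (zero_lt_one.trans_le hd)]
      exact hs
  rw [Metric.tendsto_atTop]
  intro ε hε
  obtain ⟨N, hN⟩ := iterate_average_tendsto_integral hf hμ (φ := φ ∘ discIncl ρ)
    (hφ.comp he.continuous) (half_pos hε)
  have hpow : Tendsto (fun n => ε / 2 + (1 - (Fintype.card ι : ℝ)⁻¹) ^ n * C) atTop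
      (𝓝 (ε / 2 + 0 * C)) :=
    ((tendsto_pow_atTop_nhds_zero_of_lt_one hq0 hq1).mul_const C).const_add _
  obtain ⟨M, hM⟩ := eventually_atTop.1 (hpow.eventually_lt_const
    (show ε / 2 + 0 * C < ε by linarith))
  refine ⟨M + N, fun n hn => ?_⟩
  -- The first N averagings make φ nearly constant on the disc; the other m absorb the points that
  -- are still outside.
  obtain ⟨m, rfl⟩ := Nat.exists_eq_add_of_le' (show N ≤ n by omega)
  rw [dist_eq_norm, Function.iterate_add_apply]
  refine (norm_iterate_mean_sub_le hF hcard hret (hbound N) (fun x => ?_) (half_pos hε).le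
    m a).trans_lt (hM m (by omega))
  rw [iterate_mean_discIncl hF]
  exact hN N le_rfl x

lemma diracSum_map_apply (e : ι → Sphere) (s : Set Sphere) :
    diracSum (Finset.univ.val.map e) s = ∑ i, Measure.dirac (e i) s := by
  rw [diracSum, Multiset.map_map]
  exact Measure.finsetSum_apply _ _ _

/-- The measure lives on the disc, so measurability of the kernel is needed only there, where it
follows from continuity of the branches. -/
lemma pushforward_map_discIncl [Nonempty ι] (hf : ∀ i, Continuous (f i))
    (hF : ∀ x, F (discIncl ρ x) = Finset.univ.val.map fun i => discIncl ρ (f i x))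
    {μ : Measure (Metric.closedBall (0 : ℂ) ρ)} (hμ : averageMeasure f μ = μ) :
    pushforward F (μ.map (discIncl ρ)) = (Fintype.card ι : ENNReal) • μ.map (discIncl ρ) := by
  have he := isClosedEmbedding_discIncl ρ
  have hm := he.measurableEmbedding
  have hmeas : AEMeasurable (fun a => diracSum (F a)) (μ.map (discIncl ρ)) := by
    rw [hm.aemeasurable_map_iff]
    refine (Measure.measurable_of_measurable_coe _ fun s hs => ?_).aemeasurable
    simp only [Function.comp_def, hF, diracSum_map_apply, Measure.dirac_apply' _ hs]
    exact Finset.measurable_sum _ fun i _ =>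
      (measurable_one.indicator hs).comp (hm.measurable.comp (hf i).measurable)
  ext s hs
  rw [pushforward, Measure.bind_apply hs hmeas, hm.lintegral_map, Measure.smul_apply,
    hm.map_apply]
  conv_rhs => rw [← hμ, averageMeasure_apply hf μ (hm.measurable hs)]
  rw [smul_eq_mul, ← mul_assoc, ENNReal.mul_inv_cancel (by simp) (by simp), one_mul]
  simp only [hF, diracSum_map_apply, Measure.dirac_apply' _ hs]
  have hmi : ∀ i, Measurable fun x => discIncl ρ (f i x) := fun i =>
    hm.measurable.comp (hf i).measurable
  rw [lintegral_finsetSum (f := fun i x => s.indicator 1 (discIncl ρ (f i x))) _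
    fun i _ => (measurable_one.indicator hs).comp (hmi i)]
  refine Finset.sum_congr rfl fun i _ => ?_
  exact lintegral_indicator_one (hmi i hs)

end Dynamics

/-! ### Closure of the curve in the sphere, and the equilibrium measure -/

instance instMetrizableSpaceSphere : TopologicalSpace.MetrizableSpace Sphere :=
  (onePointEquivSphereOfFinrankEq (ι := Fin 3) (V := ℂ)
    (by simp [Complex.finrank_real_complex])).isEmbedding.metrizableSpace

lemma coe_mem_image_coe {R : MvPolynomial (Fin 2) ℂ} {z w : ℂ}
    (h : MvPolynomial.eval ![z, w] R = 0) : (w : Sphere) ∈ image R (z : Sphere) :=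
  subset_closure ⟨z, w, h, rfl⟩

lemma isClosed_curve (R : MvPolynomial (Fin 2) ℂ) : IsClosed (curve R) := isClosed_closure

lemma continuous_eval_pair (R : MvPolynomial (Fin 2) ℂ) :
    Continuous fun p : ℂ × ℂ => MvPolynomial.eval ![p.1, p.2] R := by
  refine (MvPolynomial.continuous_eval R).comp (continuous_pi fun i => ?_)
  fin_cases i
  · exact continuous_fst
  · exact continuous_snd

/-- If every finite fibre has a point in a fixed disc, then so does the fibre over `∞`. -/
lemma exists_coe_mem_image_infty {R : MvPolynomial (Fin 2) ℂ} {ρ : ℝ}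
    (h : ∀ z : ℂ, ∃ w : ℂ, ‖w‖ ≤ ρ ∧ MvPolynomial.eval ![z, w] R = 0) :
    ∃ w : ℂ, (w : Sphere) ∈ image R OnePoint.infty := by
  let K : Set Sphere := (fun w : ℂ => (w : Sphere)) '' Metric.closedBall 0 ρ
  have hK : IsCompact K := (isCompact_closedBall _ _).image OnePoint.continuous_coe
  -- The projection of a compact set is closed. Since it contains all finite points, which are
  -- dense, it contains ∞.
  let T : Set Sphere := Prod.fst '' (curve R ∩ Set.univ ×ˢ K)
  have hT : IsClosed T :=
    (((isClosed_curve R).inter (isClosed_univ.prod hK.isClosed)).isCompact.image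
      continuous_fst).isClosed
  have hdense : Dense (Set.range fun z : ℂ => (z : Sphere)) := OnePoint.denseRange_coe
  have hsub : Set.range (fun z : ℂ => (z : Sphere)) ⊆ T := by
    rintro _ ⟨z, rfl⟩
    obtain ⟨w, hw, hzw⟩ := h z
    exact ⟨(z, w), ⟨coe_mem_image_coe hzw, trivial, w, by simpa using hw, rfl⟩, rfl⟩
  obtain ⟨⟨a, b⟩, ⟨hab, -, w, -, rfl⟩, rfl⟩ :=
    hT.closure_subset_iff.2 hsub (hdense OnePoint.infty)
  exact ⟨w, hab⟩

/-- Over the open disc the closure of the affine curve has no new points, as soon as the affine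
fibres over the closed disc are bounded. -/
lemma eval_eq_zero_of_mem_image {R : MvPolynomial (Fin 2) ℂ} {ρ : ℝ}
    (h : ∀ z w : ℂ, ‖z‖ ≤ ρ → MvPolynomial.eval ![z, w] R = 0 → ‖w‖ ≤ ρ) {z : ℂ} (hz : ‖z‖ < ρ)
    {b : Sphere} (hb : b ∈ image R (z : Sphere)) :
    ∃ w : ℂ, b = w ∧ MvPolynomial.eval ![z, w] R = 0 := by
  let Z : Set (ℂ × ℂ) := (Metric.closedBall 0 ρ ×ˢ Metric.closedBall 0 ρ) ∩
    {p | MvPolynomial.eval ![p.1, p.2] R = 0}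
  have hZ : IsCompact Z := ((isCompact_closedBall _ _).prod (isCompact_closedBall _ _)).inter_right
    (isClosed_eq (continuous_eval_pair R) continuous_const)
  let e : ℂ × ℂ → Sphere × Sphere := Prod.map (fun w : ℂ => (w : Sphere)) fun w : ℂ => (w : Sphere)
  have he : Continuous e := OnePoint.continuous_coe.prodMap OnePoint.continuous_coe
  let U : Set Sphere := (fun w : ℂ => (w : Sphere)) '' Metric.ball 0 ρ
  have hU : IsOpen U := OnePoint.isOpenEmbedding_coe.isOpenMap _ Metric.isOpen_ball
  -- Taking the open disc for `U` and closed discs in `Z` makes both pieces closed, so the closure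
  -- adds nothing outside their union.
  have hsub : curve R ⊆ (Prod.fst ⁻¹' Uᶜ) ∪ e '' Z := by
    refine closure_minimal ?_
      ((hU.isClosed_compl.preimage continuous_fst).union (hZ.image he).isClosed)
    rintro _ ⟨x, y, hxy, rfl⟩
    by_cases hx : ‖x‖ ≤ ρ
    · exact Or.inr ⟨(x, y), ⟨⟨by simpa using hx, by simpa using h x y hx hxy⟩, hxy⟩, rfl⟩
    · left
      rintro ⟨x', hx', hxx'⟩
      rw [OnePoint.coe_injective hxx'] at hx'
      exact hx (by simpa using (Metric.mem_ball.1 hx').le)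
  rcases hsub hb with hb | ⟨⟨x, y⟩, ⟨-, hxy⟩, he'⟩
  · exact absurd ⟨z, by simpa using hz, rfl⟩ hb
  · obtain ⟨h1, h2⟩ := Prod.mk.inj he'
    have hxz : x = z := OnePoint.coe_injective h1
    subst hxz
    exact ⟨y, h2.symm, hxy⟩

/-- The equilibrium measure of a correspondence that is given by contractions on a disc and such
that every point has an image in this disc. -/
theorem exists_equilibriumMeasure (R : MvPolynomial (Fin 2) ℂ) {ι : Type*} [Fintype ι] [Nonempty ι]
    {ρ : ℝ} (hρ : 0 ≤ ρ) {f : ι → Metric.closedBall (0 : ℂ) ρ → Metric.closedBall (0 : ℂ) ρ}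
    (hf : ∀ i x y, dist (f i x) (f i y) ≤ 2⁻¹ * dist x y)
    (hF : ∀ x, images R (discIncl ρ x) = Finset.univ.val.map fun i => discIncl ρ (f i x))
    (hcard : ∀ a, (images R a).card = Fintype.card ι)
    (hret : ∀ a, ∃ x, discIncl ρ x ∈ images R a)
    (hfin : ∀ (z : ℂ) (b : Sphere), b ∈ images R (z : Sphere) ↔
      ∃ w : ℂ, b = w ∧ MvPolynomial.eval ![z, w] R = 0)
    {C : Set ℂ} (hC : IsClosed C) (hCρ : ∀ w ∈ C, ‖w‖ < ρ) (hfC : ∀ i x, (f i x : ℂ) ∈ C) :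
    ∃ μ : Measure Sphere, IsProbabilityMeasure μ ∧ μ.Regular ∧
      pushforward (images R) μ = (Fintype.card ι : ENNReal) • μ ∧
      (∀ a : Sphere, WeakStarTendsto
        (fun m => ((Fintype.card ι : ENNReal) ^ m)⁻¹ •
          pushforward (iter (images R) m) (Measure.dirac a)) μ) ∧
      μ.support ⊆ (fun w : ℂ => (w : Sphere)) '' C ∧
      IsLeast {S : Set Sphere | S.Nonempty ∧ IsClosed S ∧ ForwardInvariant R S} μ.support := by
  have : CompactSpace (Metric.closedBall (0 : ℂ) ρ) :=
    isCompact_iff_compactSpace.1 (isCompact_closedBall _ _)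
  have : Nonempty (Metric.closedBall (0 : ℂ) ρ) := ⟨⟨0, by simpa using hρ⟩⟩
  have he := isClosedEmbedding_discIncl ρ
  have hc : ∀ i, Continuous (f i) := fun i =>
    (LipschitzWith.of_dist_le_mul (K := 2⁻¹) (by simpa using hf i)).continuous
  obtain ⟨μ, hprob, hμ⟩ := exists_averageMeasure_eq hf
  have hprob' : IsProbabilityMeasure (μ.map (discIncl ρ)) :=
    Measure.isProbabilityMeasure_map he.continuous.measurable.aemeasurable
  have hsupp : (μ.map (discIncl ρ)).support = discIncl ρ '' μ.support :=
    support_map_of_isClosedEmbedding he μ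
  have hsuppC : μ.support ⊆ {x | (x : ℂ) ∈ C} :=
    support_subset_of_averageMeasure_eq hc hμ (hC.preimage continuous_subtype_val) hfC
  have hret' : ∀ z : ℂ, ∃ w : ℂ, ‖w‖ ≤ ρ ∧ MvPolynomial.eval ![z, w] R = 0 := by
    intro z
    obtain ⟨x, hx⟩ := hret z
    obtain ⟨w, hxw, hw⟩ := (hfin z _).1 hx
    have : (x : ℂ) = w := OnePoint.coe_injective hxw
    exact ⟨w, this ▸ mem_closedBall_zero_iff.1 x.2, hw⟩
  have hbranch : ∀ (x : Metric.closedBall (0 : ℂ) ρ) (w : ℂ),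
      MvPolynomial.eval ![(x : ℂ), w] R = 0 → ∃ i, w = f i x := by
    intro x w hw
    have : (w : Sphere) ∈ images R (discIncl ρ x) := (hfin x _).2 ⟨w, rfl, hw⟩
    rw [hF] at this
    obtain ⟨i, -, hi⟩ := Multiset.mem_map.1 this
    exact ⟨i, (OnePoint.coe_injective hi).symm⟩
  have hbdd : ∀ z w : ℂ, ‖z‖ ≤ ρ → MvPolynomial.eval ![z, w] R = 0 → ‖w‖ ≤ ρ := by
    intro z w hz hzw
    obtain ⟨i, rfl⟩ := hbranch ⟨z, by simpa using hz⟩ w hzw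
    exact mem_closedBall_zero_iff.1 (f i _).2
  -- The values are general because weak-* convergence is tested on complex functions and minimality
  -- on real ones.
  have hlim : ∀ {E : Type} [NormedAddCommGroup E] [NormedSpace ℝ E] [SecondCountableTopology E]
      [CompleteSpace E] {φ : Sphere → E}, Continuous φ → ∀ a,
      Tendsto (fun n => (mean (Fintype.card ι) (images R))^[n] φ a) atTop
        (𝓝 (∫ y, φ y ∂(μ.map (discIncl ρ)))) :=
    fun hφ a => tendsto_iterate_mean hf hF hcard hret hμ hφ a
  refine ⟨μ.map (discIncl ρ), hprob', inferInstance, pushforward_map_discIncl hc hF hμ,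
    fun a φ => ?_, ?_, ⟨?_, Measure.isClosed_support, ?_⟩, ?_⟩
  · simp_rw [integral_pushforward_iter_dirac _ _ _ _ φ.continuous]
    exact hlim φ.continuous a
  · rw [hsupp]
    rintro _ ⟨x, hx, rfl⟩
    exact ⟨x, hsuppC hx, rfl⟩
  · exact Measure.nonempty_support (IsProbabilityMeasure.ne_zero _)
  · rw [hsupp]
    rintro _ ⟨x, hx, rfl⟩ b hb
    obtain ⟨w, rfl, hw⟩ := eval_eq_zero_of_mem_image hbdd (hCρ _ (hsuppC hx)) hb
    obtain ⟨i, rfl⟩ := hbranch x w hw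
    exact ⟨f i x, apply_mem_support_of_averageMeasure_eq hc hμ hx i, rfl⟩
  · rintro S ⟨⟨a, ha⟩, hS, hinv⟩
    obtain ⟨z, hz⟩ : ∃ z : ℂ, (z : Sphere) ∈ S := by
      induction a using OnePoint.rec with
      | infty =>
        obtain ⟨w, hw⟩ := exists_coe_mem_image_infty hret'
        exact ⟨w, hinv _ ha hw⟩
      | coe z => exact ⟨z, ha⟩
    refine support_subset_of_forall_integral_eq_zero hS fun φ hφ => ?_
    -- The restriction to finite points is needed because `hfin` relates `images` to the curve only
    -- there; by `hfin` finite points have only finite images.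
    have hzero := iterate_mean_eq_zero_of_forall_mem (Fintype.card ι) (F := images R)
      (S := S ∩ Set.range fun w : ℂ => (w : Sphere)) (φ := φ) ?_ (fun a ha => hφ a ha.1)
    · refine tendsto_nhds_unique (hlim φ.continuous z) ?_
      simp_rw [fun n => hzero n z ⟨hz, z, rfl⟩]
      exact tendsto_const_nhds
    · rintro _ ⟨hx, x, rfl⟩ b hb
      obtain ⟨w, rfl, hw⟩ := (hfin x b).1 hb
      exact ⟨hinv _ hx (coe_mem_image_coe hw), w, rfl⟩

/-! ### Size of roots and coefficients -/

section Roots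

open Polynomial

/-- For ρ > 0, the ratio of the k-th to the constant coefficient is, up to sign, an elementary
symmetric function of the reciprocal roots; 2 to the number of roots bounds its number of terms. The
induction avoids division. -/
lemma norm_coeff_prod_X_sub_C_le {ρ : ℝ} (hρ : 0 ≤ ρ) (s : Multiset ℂ)
    (hs : ∀ w ∈ s, ρ ≤ ‖w‖) (k : ℕ) :
    ρ ^ k * ‖((s.map fun w => X - C w).prod).coeff k‖ ≤
      2 ^ s.card * ‖((s.map fun w => X - C w).prod).coeff 0‖ := by
  induction s using Multiset.induction_on generalizing k with
  | empty =>
    rcases k with _ | k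
    · simp
    · simp [coeff_one]
  | cons w s ih =>
    have ih := ih fun v hv => hs v (Multiset.mem_cons_of_mem hv)
    have hw := hs w (Multiset.mem_cons_self w s)
    rw [Multiset.map_cons, Multiset.prod_cons, Multiset.card_cons]
    set q := (s.map fun w => X - C w).prod
    have h0 : ‖((X - C w) * q).coeff 0‖ = ‖w‖ * ‖q.coeff 0‖ := by
      simp [mul_coeff_zero]
    rcases k with _ | k
    · rw [pow_zero, one_mul]
      exact le_mul_of_one_le_left (norm_nonneg _) (one_le_pow₀ one_le_two)
    · have hk : ((X - C w) * q).coeff (k + 1) = q.coeff k - w * q.coeff (k + 1) := by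
        simp [sub_mul]
      rw [hk, h0]
      have h1 := ih k
      have h2 := ih (k + 1)
      set T := 2 ^ s.card * ‖q.coeff 0‖ with hT
      have hT0 : 0 ≤ T := by positivity
      calc ρ ^ (k + 1) * ‖q.coeff k - w * q.coeff (k + 1)‖
          ≤ ρ ^ (k + 1) * (‖q.coeff k‖ + ‖w‖ * ‖q.coeff (k + 1)‖) := by
            gcongr
            exact (norm_sub_le _ _).trans_eq (by rw [norm_mul])
        _ = ρ * (ρ ^ k * ‖q.coeff k‖) + ‖w‖ * (ρ ^ (k + 1) * ‖q.coeff (k + 1)‖) := by ring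
        _ ≤ ‖w‖ * T + ‖w‖ * T := by gcongr
        _ = 2 ^ (s.card + 1) * (‖w‖ * ‖q.coeff 0‖) := by rw [hT]; ring

/-- If all the zeros of a polynomial are outside a disc of radius `ρ`, then its coefficients are
controlled by the constant one. -/
lemma norm_coeff_le_of_forall_root {p : ℂ[X]} {ρ : ℝ} (hρ : 1 ≤ ρ)
    (h : ∀ w ∈ p.roots, ρ ≤ ‖w‖) {k : ℕ} (hk : k ≠ 0) :
    ρ * ‖p.coeff k‖ ≤ 2 ^ p.natDegree * ‖p.coeff 0‖ := by
  have hs := IsAlgClosed.splits p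
  have hp := hs.eq_prod_roots
  have hc := norm_coeff_prod_X_sub_C_le (zero_le_one.trans hρ) p.roots h k
  rw [← hs.natDegree_eq_card_roots] at hc
  have hk' : ρ ≤ ρ ^ k := le_self_pow₀ hρ hk
  have hcoeff : ∀ m, ‖p.coeff m‖ =
      ‖p.leadingCoeff‖ * ‖((p.roots.map fun w => X - C w).prod).coeff m‖ := by
    intro m
    conv_lhs => rw [hp, coeff_C_mul, norm_mul]
  rw [hcoeff, hcoeff 0]
  calc _ ≤ ρ ^ k * (‖p.leadingCoeff‖ * ‖((p.roots.map fun w => X - C w).prod).coeff k‖) := by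
        gcongr
    _ = ‖p.leadingCoeff‖ * (ρ ^ k * ‖((p.roots.map fun w => X - C w).prod).coeff k‖) := by ring
    _ ≤ ‖p.leadingCoeff‖ *
        (2 ^ p.natDegree * ‖((p.roots.map fun w => X - C w).prod).coeff 0‖) := by gcongr
    _ = _ := by ring

lemma exists_root_norm_sub_lt {p : ℂ[X]} {u : ℂ} {r : ℝ} (hr : 0 < r)
    (h : ‖p.eval u‖ < ‖p.leadingCoeff‖ * r ^ p.natDegree) : ∃ w ∈ p.roots, ‖w - u‖ < r := by
  by_contra! hcon
  have hs := IsAlgClosed.splits p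
  refine h.not_ge ?_
  rw [hs.eval_eq_prod_roots u, norm_mul, hs.natDegree_eq_card_roots]
  gcongr
  generalize p.roots = s at hcon
  induction s using Multiset.induction_on with
  | empty => simp
  | cons w s ih =>
    rw [Multiset.card_cons, Multiset.map_cons, Multiset.prod_cons, norm_mul, pow_succ']
    have := hcon w (Multiset.mem_cons_self w s)
    rw [norm_sub_rev] at this
    exact mul_le_mul this (ih fun v hv => hcon v (Multiset.mem_cons_of_mem hv)) (by positivity)
      (norm_nonneg _)

/-- In the factorization of `p.eval w`, all factors except the i-th are at least `s`. A small value
of `p` thus forces `w` to be close to the i-th root, which makes the branches Lipschitz. -/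
lemma norm_sub_mul_le_norm_eval {ι : Type*} [Fintype ι] {p : ℂ[X]} {g : ι → ℂ}
    (hg : p.roots = Finset.univ.val.map g) {s : ℝ} (hs : 0 ≤ s) {w : ℂ} (i : ι)
    (h : ∀ k ≠ i, s ≤ ‖w - g k‖) :
    ‖p.leadingCoeff‖ * s ^ (Fintype.card ι - 1) * ‖w - g i‖ ≤ ‖p.eval w‖ := by
  classical
  rw [(IsAlgClosed.splits p).eval_eq_prod_roots w, hg, Multiset.map_map, norm_mul, mul_assoc]
  gcongr
  change _ ≤ ‖∏ k, (w - g k)‖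
  rw [norm_prod, ← Finset.mul_prod_erase _ _ (Finset.mem_univ i), mul_comm]
  gcongr
  rw [← Finset.card_univ, ← Finset.card_erase_of_mem (Finset.mem_univ i)]
  rw [← Finset.prod_const]
  exact Finset.prod_le_prod (fun _ _ => hs) fun k hk => h k (Finset.ne_of_mem_erase hk)

lemma norm_sum_pow_le (b : ℕ → ℂ) (n : ℕ) {a : ℂ} (ha : 1 ≤ ‖a‖) :
    ‖∑ l ∈ Finset.range (n + 1), b l * a ^ l‖ ≤
      (∑ l ∈ Finset.range (n + 1), ‖b l‖) * ‖a‖ ^ n := by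
  rw [Finset.sum_mul]
  refine norm_sum_le_of_le _ fun l hl => ?_
  rw [norm_mul, norm_pow]
  gcongr
  exact Nat.lt_succ_iff.1 (Finset.mem_range.1 hl)

lemma exists_le_norm_sum_pow (b : ℕ → ℂ) (n : ℕ) (hb : b n ≠ 0) :
    ∃ M : ℝ, 1 ≤ M ∧ ∀ a : ℂ, M ≤ ‖a‖ →
      ‖b n‖ / 2 * ‖a‖ ^ n ≤ ‖∑ l ∈ Finset.range (n + 1), b l * a ^ l‖ := by
  set A := ∑ l ∈ Finset.range n, ‖b l‖
  have hb' : 0 < ‖b n‖ := norm_pos_iff.2 hb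
  -- Beyond this radius the lower-order terms amount to at most half of the top one.
  refine ⟨max 1 (2 * A / ‖b n‖), le_max_left _ _, fun a ha => ?_⟩
  have ha1 : 1 ≤ ‖a‖ := (le_max_left _ _).trans ha
  have ha2 : 2 * A / ‖b n‖ ≤ ‖a‖ := (le_max_right _ _).trans ha
  have hrest : ‖a‖ * ‖∑ l ∈ Finset.range n, b l * a ^ l‖ ≤ A * ‖a‖ ^ n := by
    rw [← norm_mul, Finset.mul_sum, Finset.sum_mul]
    refine norm_sum_le_of_le _ fun l hl => ?_
    rw [norm_mul, norm_mul, norm_pow]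
    calc ‖a‖ * (‖b l‖ * ‖a‖ ^ l) = ‖b l‖ * ‖a‖ ^ (l + 1) := by ring
      _ ≤ ‖b l‖ * ‖a‖ ^ n := by
        gcongr
        exact Finset.mem_range.1 hl
  have hA : A ≤ ‖a‖ * (‖b n‖ / 2) := by
    rw [div_le_iff₀ hb'] at ha2; linarith
  have hrest' : ‖∑ l ∈ Finset.range n, b l * a ^ l‖ ≤ ‖b n‖ / 2 * ‖a‖ ^ n := by
    refine le_of_mul_le_mul_left (hrest.trans ?_) (zero_lt_one.trans_le ha1)
    rw [← mul_assoc]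
    gcongr
  rw [Finset.sum_range_succ, add_comm]
  have h1 := norm_sub_le_norm_add (b n * a ^ n) (∑ l ∈ Finset.range n, b l * a ^ l)
  have h2 : ‖b n * a ^ n‖ = ‖b n‖ * ‖a‖ ^ n := by rw [norm_mul, norm_pow]
  linarith

end Roots

/-! ### Fibres of the perturbed polynomial, finite and at infinity -/

section Fibres

open Polynomial

lemma eval_fibre (R : MvPolynomial (Fin 2) ℂ) (z w : ℂ) :
    (fibre R (z : Sphere)).eval w = MvPolynomial.eval ![z, w] R := by
  change (Polynomial.aeval w : ℂ[X] →ₐ[ℂ] ℂ) (MvPolynomial.aeval ![C z, X] R) = _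
  rw [← AlgHom.comp_apply, ← MvPolynomial.coe_aeval_eq_eval]
  change _ = MvPolynomial.aeval ![z, w] R
  congr 1
  ext i
  fin_cases i <;> simp

lemma natDegree_fibre_le (R : MvPolynomial (Fin 2) ℂ) (z : ℂ) :
    (fibre R (z : Sphere)).natDegree ≤ MvPolynomial.degreeOf 1 R := by
  change (MvPolynomial.aeval ![C z, X] R : ℂ[X]).natDegree ≤ _
  rw [MvPolynomial.aeval_def, MvPolynomial.eval₂_eq']
  refine natDegree_sum_le_of_forall_le _ _ fun m hm => ?_
  have := MvPolynomial.monomial_le_degreeOf 1 hm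
  rw [Fin.prod_univ_two]
  simp only [Matrix.cons_val_zero, Matrix.cons_val_one, ← C_pow, algebraMap_eq]
  rw [← mul_assoc, ← C_mul]
  exact (natDegree_C_mul_X_pow_le _ _).trans this

lemma card_images (R : MvPolynomial (Fin 2) ℂ) (a : Sphere)
    (h : (fibre R a).natDegree ≤ MvPolynomial.degreeOf 1 R) :
    (images R a).card = MvPolynomial.degreeOf 1 R := by
  rw [images, Multiset.card_add, Multiset.card_map, Multiset.card_replicate,
    ← (IsAlgClosed.splits _).natDegree_eq_card_roots]
  omega

lemma images_coe_eq (R : MvPolynomial (Fin 2) ℂ) (z : ℂ)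
    (h : (fibre R (z : Sphere)).natDegree = MvPolynomial.degreeOf 1 R) :
    images R (z : Sphere) = (fibre R (z : Sphere)).roots.map fun w : ℂ => (w : Sphere) := by
  rw [images, h, Nat.sub_self, Multiset.replicate_zero, add_zero]

/-- The polynomial with the expansion coefficients `Q i` in powers of `w - z`. -/
def diagonalSum (d : ℕ) (Q : ℕ → ℂ[X]) : MvPolynomial (Fin 2) ℂ :=
  ∑ i ∈ Finset.range (d + 1),
    aeval (MvPolynomial.X 1) (Q i) * (MvPolynomial.X 1 - MvPolynomial.X 0) ^ (d - i)

variable {d : ℕ} {Q : ℕ → ℂ[X]}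

lemma aeval_diagonalSum {A : Type*} [CommRing A] [Algebra ℂ A] (x y : A) :
    MvPolynomial.aeval ![x, y] (diagonalSum d Q) =
      ∑ i ∈ Finset.range (d + 1), aeval y (Q i) * (y - x) ^ (d - i) := by
  simp only [diagonalSum, map_sum, map_mul, map_pow, map_sub, ← aeval_algHom_apply,
    MvPolynomial.aeval_X, Matrix.cons_val_zero, Matrix.cons_val_one]

lemma aeval_perturb {A : Type*} [CommRing A] [Algebra ℂ A] (R₀ : ℂ[X])
    (P : MvPolynomial (Fin 2) ℂ) (δ : ℂ) (x y : A) :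
    MvPolynomial.aeval ![x, y] (perturb R₀ P δ) =
      aeval y R₀ + algebraMap ℂ A δ * MvPolynomial.aeval ![x, y] P := by
  simp only [perturb, map_add, map_mul, ← aeval_algHom_apply, MvPolynomial.aeval_X,
    Matrix.cons_val_one, MvPolynomial.aeval_C]
  rfl

lemma fibre_perturb_coe (R₀ : ℂ[X]) (P : MvPolynomial (Fin 2) ℂ) (δ z : ℂ) :
    fibre (perturb R₀ P δ) (z : Sphere) = R₀ + C δ * fibre P (z : Sphere) := by
  change MvPolynomial.aeval ![C z, X] (perturb R₀ P δ) = _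
  rw [aeval_perturb, aeval_X_left_apply]
  rfl

lemma fibre_diagonalSum (z : ℂ) : fibre (diagonalSum d Q) (z : Sphere) =
    ∑ i ∈ Finset.range (d + 1), Q i * (X - C z) ^ (d - i) := by
  change MvPolynomial.aeval ![C z, X] (diagonalSum d Q) = _
  simp only [aeval_diagonalSum, aeval_X_left_apply]

lemma natDegree_fibre_diagonalSum_le (hQ : ∀ i ≤ d, (Q i).natDegree ≤ i) (z : ℂ) :
    (fibre (diagonalSum d Q) (z : Sphere)).natDegree ≤ d := by
  rw [fibre_diagonalSum]
  refine natDegree_sum_le_of_forall_le _ _ fun i hi => ?_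
  have hi' : i ≤ d := Nat.lt_succ_iff.1 (Finset.mem_range.1 hi)
  refine natDegree_mul_le.trans ?_
  have := hQ i hi'
  rw [natDegree_pow, natDegree_X_sub_C]
  omega

lemma coeff_X_sub_C_pow_self {A : Type*} [CommRing A] [IsDomain A] (a : A) (n : ℕ) :
    ((X - C a) ^ n).coeff n = 1 := by
  have h := ((monic_X_sub_C a).pow n).coeff_natDegree
  rwa [natDegree_pow, natDegree_X_sub_C, mul_one] at h

/-- The top coefficient does not depend on z because the powers of w - z are monic in w. This allows
a bound on δ that is uniform in z. -/
lemma coeff_fibre_diagonalSum (hQ : ∀ i ≤ d, (Q i).natDegree ≤ i) (z : ℂ) :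
    (fibre (diagonalSum d Q) (z : Sphere)).coeff d =
      ∑ i ∈ Finset.range (d + 1), (Q i).coeff i := by
  rw [fibre_diagonalSum, finsetSum_coeff]
  refine Finset.sum_congr rfl fun i hi => ?_
  have hi' : i ≤ d := Nat.lt_succ_iff.1 (Finset.mem_range.1 hi)
  have hn : ((X - C z) ^ (d - i)).natDegree = d - i := by
    rw [natDegree_pow, natDegree_X_sub_C, mul_one]
  have h := coeff_mul_add_eq_of_natDegree_le (hQ i hi') hn.le
  rw [Nat.add_sub_cancel' hi'] at h
  rw [h]
  rw [coeff_X_sub_C_pow_self, mul_one]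

/-- The polynomial as a polynomial in `z` with coefficients in `ℂ[w]`. -/
def collectZ (P : MvPolynomial (Fin 2) ℂ) : ℂ[X][X] := MvPolynomial.aeval ![X, C X] P

lemma eval_collectZ (P : MvPolynomial (Fin 2) ℂ) (z : ℂ) :
    (collectZ P).eval (C z) = fibre P (z : Sphere) := by
  change (evalRingHom (C z)) (MvPolynomial.aeval ![X, C X] P) = MvPolynomial.aeval ![C z, X] P
  induction P using MvPolynomial.induction_on with
  | C a => simp [Polynomial.algebraMap_apply]
  | add p q hp hq => rw [map_add, map_add, map_add, hp, hq]
  | mul_X p i hp =>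
    rw [map_mul, map_mul, map_mul, hp]
    congr 1
    fin_cases i <;> simp

lemma coeff_fibre_eq_sum {P : MvPolynomial (Fin 2) ℂ} {n : ℕ} (hn : (collectZ P).natDegree ≤ n)
    (z : ℂ) (m : ℕ) : (fibre P (z : Sphere)).coeff m =
      ∑ l ∈ Finset.range (n + 1), ((collectZ P).coeff l).coeff m * z ^ l := by
  rw [← eval_collectZ, eval_eq_sum_range' (Nat.lt_succ_iff.2 hn), finsetSum_coeff]
  refine Finset.sum_congr rfl fun l _ => ?_
  rw [← C_pow, coeff_mul_C]

lemma aeval_C_X (q : ℂ[X]) : aeval (C X : ℂ[X][X]) q = C q := by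
  have h := aeval_algHom_apply (CAlgHom : ℂ[X] →ₐ[ℂ] ℂ[X][X]) X q
  simpa using h

lemma natDegree_C_X_sub_X_pow_le (n : ℕ) : ((C X - X : ℂ[X][X]) ^ n).natDegree ≤ n := by
  refine natDegree_pow_le.trans ?_
  rw [natDegree_sub, natDegree_X_sub_C, mul_one]

lemma coeff_C_X_sub_X_pow (n : ℕ) : ((C X - X : ℂ[X][X]) ^ n).coeff n = (-1) ^ n := by
  have h : (C X - X : ℂ[X][X]) ^ n = C ((-1) ^ n) * (X - C X) ^ n := by
    rw [C_pow, C_neg, C_1, ← mul_pow]; congr 1; ring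
  rw [h, coeff_C_mul, coeff_X_sub_C_pow_self, mul_one]

lemma collectZ_diagonalSum : collectZ (diagonalSum d Q) =
    ∑ i ∈ Finset.range (d + 1), C (Q i) * (C X - X) ^ (d - i) := by
  simp only [collectZ, aeval_diagonalSum, aeval_C_X]

lemma natDegree_collectZ_diagonalSum_le {j : ℕ} (hj : ∀ i < j, Q i = 0) :
    (collectZ (diagonalSum d Q)).natDegree ≤ d - j := by
  rw [collectZ_diagonalSum]
  refine natDegree_sum_le_of_forall_le _ _ fun i _ => ?_
  by_cases hi : i < j
  · simp [hj i hi]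
  · refine (natDegree_C_mul_le _ _).trans ((natDegree_C_X_sub_X_pow_le _).trans ?_)
    omega

lemma coeff_collectZ_diagonalSum {j : ℕ} (hjd : j < d) (hj : ∀ i < j, Q i = 0) :
    (collectZ (diagonalSum d Q)).coeff (d - j) = (-1) ^ (d - j) * Q j := by
  rw [collectZ_diagonalSum, finsetSum_coeff,
    Finset.sum_eq_single_of_mem j (Finset.mem_range.2 (by omega)), coeff_C_mul,
    coeff_C_X_sub_X_pow, mul_comm]
  intro i hi hij
  have hi' : i ≤ d := Nat.lt_succ_iff.1 (Finset.mem_range.1 hi)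
  by_cases hlt : i < j
  · simp [hj i hlt]
  · rw [coeff_C_mul, coeff_eq_zero_of_natDegree_lt, mul_zero]
    exact (natDegree_C_X_sub_X_pow_le _).trans_lt (by omega)

lemma fibre_perturb_infty_zero (R₀ : ℂ[X]) (P : MvPolynomial (Fin 2) ℂ) :
    fibre (perturb R₀ P 0) OnePoint.infty = R₀ := by
  change (MvPolynomial.aeval ![X, C X] (perturb R₀ P 0) : ℂ[X][X]).leadingCoeff = R₀
  rw [aeval_perturb, aeval_C_X, map_zero, zero_mul, add_zero, leadingCoeff_C]

/-- Since d - j > 0, the term R₀, constant in z, does not reach the top power of z. For δ = 0 the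
fibre jumps to R₀, whence the separate lemma `fibre_perturb_infty_zero`. -/
lemma fibre_perturb_diagonalSum_infty (R₀ : ℂ[X]) {j : ℕ} (hjd : j < d) (hj : ∀ i < j, Q i = 0)
    (hjne : Q j ≠ 0) {δ : ℂ} (hδ : δ ≠ 0) :
    fibre (perturb R₀ (diagonalSum d Q) δ) OnePoint.infty =
      C δ * ((-1) ^ (d - j) * Q j) := by
  change (MvPolynomial.aeval ![X, C X] (perturb R₀ (diagonalSum d Q) δ) : ℂ[X][X]).leadingCoeff = _
  rw [aeval_perturb, aeval_C_X]
  change (C R₀ + C (C δ) * collectZ (diagonalSum d Q)).leadingCoeff = _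
  have hcoeff : (C R₀ + C (C δ) * collectZ (diagonalSum d Q)).coeff (d - j) =
      C δ * ((-1) ^ (d - j) * Q j) := by
    rw [coeff_add, coeff_C_of_ne_zero (by omega), zero_add, coeff_C_mul,
      coeff_collectZ_diagonalSum hjd hj]
  have hne : C δ * ((-1) ^ (d - j) * Q j) ≠ 0 :=
    mul_ne_zero (C_ne_zero.2 hδ) (mul_ne_zero (pow_ne_zero _ (by simp)) hjne)
  have hle : (C R₀ + C (C δ) * collectZ (diagonalSum d Q)).natDegree ≤ d - j := by
    refine natDegree_add_le_of_degree_le (by simp) ?_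
    exact (natDegree_C_mul_le _ _).trans (natDegree_collectZ_diagonalSum_le hj)
  rw [leadingCoeff, natDegree_eq_of_le_of_coeff_ne_zero hle (by rwa [hcoeff]), hcoeff]

lemma totalDegree_aeval_X_le (q : ℂ[X]) (i : Fin 2) :
    (aeval (MvPolynomial.X i : MvPolynomial (Fin 2) ℂ) q).totalDegree ≤ q.natDegree := by
  rw [aeval_eq_sum_range]
  refine MvPolynomial.totalDegree_finsetSum_le fun k hk => ?_
  refine (MvPolynomial.totalDegree_smul_le _ _).trans ?_
  rw [MvPolynomial.totalDegree_X_pow]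
  exact Nat.lt_succ_iff.1 (Finset.mem_range.1 hk)

lemma degreeOf_perturb_le {R₀ : ℂ[X]} {P : MvPolynomial (Fin 2) ℂ} (hR : R₀.natDegree ≤ d)
    (hP : P.totalDegree ≤ d) (δ : ℂ) : MvPolynomial.degreeOf 1 (perturb R₀ P δ) ≤ d := by
  refine (MvPolynomial.degreeOf_le_totalDegree _ _).trans ?_
  refine (MvPolynomial.totalDegree_add _ _).trans
    (max_le ((totalDegree_aeval_X_le _ _).trans hR) ?_)
  refine (MvPolynomial.totalDegree_mul _ _).trans ?_
  rwa [MvPolynomial.totalDegree_C, zero_add]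

lemma exists_lipschitz_bound (P : MvPolynomial (Fin 2) ℂ) (ρ : ℝ) :
    ∃ L : ℝ, 0 ≤ L ∧ ∀ z z' w : ℂ, ‖z‖ ≤ ρ → ‖z'‖ ≤ ρ → ‖w‖ ≤ ρ →
      ‖MvPolynomial.eval ![z, w] P‖ ≤ L ∧
      ‖MvPolynomial.eval ![z, w] P - MvPolynomial.eval ![z', w] P‖ ≤ L * ‖z - z'‖ := by
  induction P using MvPolynomial.induction_on with
  | C a => exact ⟨‖a‖, norm_nonneg _, fun z z' w _ _ _ => by simp; positivity⟩
  | add p q hp hq =>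
    obtain ⟨L, hL0, hL⟩ := hp
    obtain ⟨L', hL0', hL'⟩ := hq
    refine ⟨L + L', add_nonneg hL0 hL0', fun z z' w hz hz' hw => ?_⟩
    obtain ⟨h1, h2⟩ := hL z z' w hz hz' hw
    obtain ⟨h1', h2'⟩ := hL' z z' w hz hz' hw
    rw [map_add, map_add, add_sub_add_comm, add_mul]
    exact ⟨(norm_add_le _ _).trans (add_le_add h1 h1'),
      (norm_add_le _ _).trans (add_le_add h2 h2')⟩
  | mul_X p i hp =>
    obtain ⟨L, hL0, hL⟩ := hp
    -- Product rule: one term from the increment of `p`, one from that of the variable. The sign of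
    -- ρ is unknown, hence the absolute value.
    refine ⟨L * |ρ| + L, by positivity, fun z z' w hz hz' hw => ?_⟩
    obtain ⟨h1, h2⟩ := hL z z' w hz hz' hw
    have hρ := le_abs_self ρ
    have key : ∀ v : ℂ, ‖v‖ ≤ |ρ| → ‖MvPolynomial.eval ![z, w] p * v‖ ≤ L * |ρ| + L := by
      intro v hv
      rw [norm_mul]
      have : ‖MvPolynomial.eval ![z, w] p‖ * ‖v‖ ≤ L * |ρ| := by gcongr
      linarith
    rw [map_mul, map_mul, MvPolynomial.eval_X, MvPolynomial.eval_X]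
    refine ⟨key _ ?_, ?_⟩
    · fin_cases i
      · exact hz.trans hρ
      · exact hw.trans hρ
    · have hd : ∀ A B v v' : ℂ, ‖A‖ ≤ L → ‖A - B‖ ≤ L * ‖z - z'‖ → ‖v'‖ ≤ |ρ| →
          ‖v - v'‖ ≤ ‖z - z'‖ → ‖A * v - B * v'‖ ≤ (L * |ρ| + L) * ‖z - z'‖ := by
        intro A B v v' hA hAB hv' hvv'
        calc ‖A * v - B * v'‖ = ‖(A - B) * v' + A * (v - v')‖ := by congr 1; ring
          _ ≤ (L * ‖z - z'‖) * |ρ| + L * ‖z - z'‖ := by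
            refine (norm_add_le _ _).trans ?_
            rw [norm_mul, norm_mul]
            gcongr
          _ = _ := by ring
      refine hd _ _ _ _ h1 h2 ?_ ?_
      · fin_cases i
        · exact hz'.trans hρ
        · exact hw.trans hρ
      · fin_cases i <;> simp

end Fibres

/-! ### Uniform control of the roots for small δ -/

section Perturbation

open Polynomial

variable {d : ℕ} {Q : ℕ → ℂ[X]} {R₀ : ℂ[X]}

lemma exists_natDegree_fibre_eq (hd : 0 < d) (hR : R₀.natDegree = d)
    (hQ : ∀ i ≤ d, (Q i).natDegree ≤ i) :
    ∃ Δ : ℝ, 0 < Δ ∧ ∀ δ : ℂ, ‖δ‖ < Δ → ∀ z : ℂ,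
      (fibre (perturb R₀ (diagonalSum d Q) δ) (z : Sphere)).natDegree = d ∧
      ‖R₀.leadingCoeff‖ / 2 ≤
        ‖(fibre (perturb R₀ (diagonalSum d Q) δ) (z : Sphere)).leadingCoeff‖ := by
  have hR0 : R₀ ≠ 0 := by rintro rfl; simp at hR; omega
  have hr : 0 < ‖R₀.leadingCoeff‖ := norm_pos_iff.2 (leadingCoeff_ne_zero.2 hR0)
  set κ := ∑ i ∈ Finset.range (d + 1), (Q i).coeff i
  refine ⟨‖R₀.leadingCoeff‖ / 2 / (‖κ‖ + 1), by positivity, fun δ hδ z => ?_⟩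
  rw [lt_div_iff₀ (by positivity)] at hδ
  rw [fibre_perturb_coe]
  set p := R₀ + C δ * fibre (diagonalSum d Q) (z : Sphere)
  have hcoeff : p.coeff d = R₀.leadingCoeff + δ * κ := by
    rw [coeff_add, coeff_C_mul, coeff_fibre_diagonalSum hQ, leadingCoeff, hR]
  have hbound : ‖R₀.leadingCoeff‖ / 2 ≤ ‖p.coeff d‖ := by
    have h1 := norm_sub_le_norm_add R₀.leadingCoeff (δ * κ)
    rw [norm_mul] at h1
    have h2 := norm_nonneg δ
    rw [hcoeff]
    linarith
  have hdeg : p.natDegree = d := by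
    refine natDegree_eq_of_le_of_coeff_ne_zero ?_ (norm_pos_iff.1 (by linarith))
    exact natDegree_add_le_of_degree_le hR.le
      ((natDegree_C_mul_le _ _).trans (natDegree_fibre_diagonalSum_le hQ z))
  exact ⟨hdeg, by rwa [show p.leadingCoeff = p.coeff d by rw [leadingCoeff, hdeg]]⟩

/-- Here τ stands for |δ||a|^(d-j). The weight `N` makes `ck + N * cd` at least `B * τ + 1`, while
`c₀` is at most `r₀ + A * τ`. Both are affine in τ, so one radius, independent of τ, contradicts
`hk` and `hd` for every τ ≥ 0. -/
lemma false_of_coeff_bounds {D r₀ rk A B ℓ N τ c₀ ck cd : ℝ} (hD : 0 < D) (hr₀ : 0 ≤ r₀)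
    (hA : 0 ≤ A) (hB : 0 < B) (hN : 0 ≤ N) (hNℓ : N * ℓ = rk + 1) (hτ : 0 ≤ τ)
    (hk : (1 + D * (1 + N) * r₀ + D * (1 + N) * A / B) * ck ≤ D * c₀)
    (hd : (1 + D * (1 + N) * r₀ + D * (1 + N) * A / B) * cd ≤ D * c₀)
    (hℓ : ℓ ≤ cd) (hc₀ : c₀ ≤ r₀ + A * τ) (hck : B * τ - rk ≤ ck) : False := by
  set W := D * (1 + N)
  have hW : 0 < W := by positivity
  set ρ := 1 + W * r₀ + W * A / B
  have hρ : 0 ≤ ρ := by positivity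
  have h1 : N * ℓ ≤ N * cd := by gcongr
  have h2 : ρ * (B * τ + 1) ≤ W * (r₀ + A * τ) := by
    calc ρ * (B * τ + 1) ≤ ρ * (ck + N * cd) := mul_le_mul_of_nonneg_left (by linarith) hρ
      _ = ρ * ck + N * (ρ * cd) := by ring
      _ ≤ D * c₀ + N * (D * c₀) := by gcongr
      _ = W * c₀ := by ring
      _ ≤ _ := by gcongr
  have h3 : ρ * (B * τ + 1) =
      1 + B * τ + W * r₀ + W * r₀ * (B * τ) + W * A / B + W * A * τ := by
    simp only [ρ]
    field_simp
    ring
  have h4 : 0 ≤ B * τ := by positivity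
  have h5 : 0 ≤ W * r₀ * (B * τ) := by positivity
  have h6 : 0 ≤ W * A / B := by positivity
  linarith

/-- Far away from the origin, every fibre has a point in a fixed disc, which depends neither on
the fibre nor on the size of the perturbation. -/
lemma exists_small_root_of_le_norm (hR : R₀.natDegree = d) (hQ : ∀ i ≤ d, (Q i).natDegree ≤ i)
    {j : ℕ} (hjd : j < d) (hj : ∀ i < j, Q i = 0) (hjdeg : (Q j).natDegree ≠ 0) :
    ∃ ρ M Δ : ℝ, 0 < Δ ∧ ∀ δ : ℂ, ‖δ‖ < Δ → ∀ a : ℂ, M ≤ ‖a‖ →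
      ∃ w ∈ (fibre (perturb R₀ (diagonalSum d Q) δ) (a : Sphere)).roots, ‖w‖ < ρ := by
  have hd : 0 < d := by omega
  have hR0 : R₀ ≠ 0 := by rintro rfl; simp at hR; omega
  have hr : 0 < ‖R₀.leadingCoeff‖ := norm_pos_iff.2 (leadingCoeff_ne_zero.2 hR0)
  have hj0 : Q j ≠ 0 := by rintro h; simp [h] at hjdeg
  obtain ⟨Δ, hΔ, hlead⟩ := exists_natDegree_fibre_eq hd hR hQ
  set k := (Q j).natDegree
  have hdeg := natDegree_collectZ_diagonalSum_le (d := d) hj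
  set n := d - j
  set b : ℕ → ℕ → ℂ := fun m l => ((collectZ (diagonalSum d Q)).coeff l).coeff m
  have hb : b k n ≠ 0 := by
    simp only [b, n]
    rw [coeff_collectZ_diagonalSum hjd hj, ← C_1, ← C_neg, ← C_pow, coeff_C_mul]
    exact mul_ne_zero (by simp) (leadingCoeff_ne_zero.2 hj0)
  obtain ⟨M, hM1, hM⟩ := exists_le_norm_sum_pow (b k) n hb
  set A := ∑ l ∈ Finset.range (n + 1), ‖b 0 l‖
  have hA : 0 ≤ A := Finset.sum_nonneg fun _ _ => norm_nonneg _
  set B := ‖b k n‖ / 2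
  have hB : 0 < B := half_pos (norm_pos_iff.2 hb)
  set ℓ := ‖R₀.leadingCoeff‖ / 2
  have hℓ : 0 < ℓ := half_pos hr
  set N := (‖R₀.coeff k‖ + 1) / ℓ
  have hN : 0 < N := by positivity
  set W : ℝ := 2 ^ d * (1 + N)
  have hW : 0 < W := by positivity
  refine ⟨1 + W * ‖R₀.coeff 0‖ + W * A / B, M, Δ, hΔ, fun δ hδ a ha => ?_⟩
  set ρ := 1 + W * ‖R₀.coeff 0‖ + W * A / B
  have hρ : 1 ≤ ρ := by
    have : 0 ≤ W * ‖R₀.coeff 0‖ + W * A / B := by positivity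
    simp only [ρ]; linarith
  by_contra! hcon
  obtain ⟨hnat, hlc⟩ := hlead δ hδ a
  -- The bound for the coefficient k requires k ≠ 0: here Q_j must be nonconstant.
  have h1 := norm_coeff_le_of_forall_root hρ hcon hjdeg
  have h2 := norm_coeff_le_of_forall_root hρ hcon hd.ne'
  have h3 : ℓ ≤ ‖(fibre (perturb R₀ (diagonalSum d Q) δ) (a : Sphere)).coeff d‖ := by
    rwa [leadingCoeff, hnat] at hlc
  rw [hnat] at h1 h2
  set τ := ‖δ‖ * ‖a‖ ^ n
  have hτ : 0 ≤ τ := by positivity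
  have hcoeff : ∀ m, (fibre (perturb R₀ (diagonalSum d Q) δ) (a : Sphere)).coeff m =
      R₀.coeff m + δ * ∑ l ∈ Finset.range (n + 1), b m l * a ^ l := by
    intro m
    rw [fibre_perturb_coe, coeff_add, coeff_C_mul, coeff_fibre_eq_sum hdeg]
  have hc0 : ‖(fibre (perturb R₀ (diagonalSum d Q) δ) (a : Sphere)).coeff 0‖ ≤
      ‖R₀.coeff 0‖ + A * τ := by
    rw [hcoeff]
    refine (norm_add_le _ _).trans ?_
    rw [norm_mul]
    have := mul_le_mul_of_nonneg_left (norm_sum_pow_le (b 0) n (hM1.trans ha)) (norm_nonneg δ)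
    simp only [τ, A]
    linarith
  have hck : B * τ - ‖R₀.coeff k‖ ≤
      ‖(fibre (perturb R₀ (diagonalSum d Q) δ) (a : Sphere)).coeff k‖ := by
    rw [hcoeff, add_comm]
    have h4 := mul_le_mul_of_nonneg_left (hM a ha) (norm_nonneg δ)
    rw [← norm_mul] at h4
    have h5 := norm_sub_le_norm_add (δ * ∑ l ∈ Finset.range (n + 1), b k l * a ^ l) (R₀.coeff k)
    have h6 : B * τ = ‖δ‖ * (B * ‖a‖ ^ n) := by simp only [τ]; ring
    linarith
  exact false_of_coeff_bounds (by positivity) (norm_nonneg (R₀.coeff 0)) hA hB hN.le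
    (div_mul_cancel₀ (‖R₀.coeff k‖ + 1) hℓ.ne') hτ h1 h2 h3 hc0 hck

lemma card_roots_toFinset (hsimple : ∀ u : ℂ, R₀.IsRoot u → R₀.rootMultiplicity u = 1) :
    R₀.roots.toFinset.card = R₀.natDegree := by
  have hnodup : R₀.roots.Nodup := by
    rw [Multiset.nodup_iff_count_le_one]
    intro u
    rw [count_roots]
    by_cases hu : R₀.IsRoot u
    · exact (hsimple u hu).le
    · rw [rootMultiplicity_eq_zero hu]; exact zero_le_one
  rw [Multiset.toFinset_card_of_nodup hnodup, (IsAlgClosed.splits R₀).natDegree_eq_card_roots]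

/-- On a disc that contains the `r`-neighbourhood of the simple zeros of `R₀`, the correspondence
of a small perturbation of `R₀` is given by contractions. -/
lemma exists_branches (hd : 0 < d) (hR : R₀.natDegree = d)
    (hcard : R₀.roots.toFinset.card = d)
    (hQ : ∀ i ≤ d, (Q i).natDegree ≤ i) {r ρ : ℝ} (hr : 0 < r)
    (hsep : ∀ u ∈ R₀.roots.toFinset, ∀ v ∈ R₀.roots.toFinset, u ≠ v → 4 * r ≤ ‖u - v‖)
    (hρ : ∀ u ∈ R₀.roots.toFinset, ‖u‖ + r ≤ ρ) :
    ∃ Δ : ℝ, 0 < Δ ∧ ∀ δ : ℂ, ‖δ‖ < Δ →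
      ∃ f : R₀.roots.toFinset → Metric.closedBall (0 : ℂ) ρ → Metric.closedBall (0 : ℂ) ρ,
        (∀ i x y, dist (f i x) (f i y) ≤ 2⁻¹ * dist x y) ∧
        (∀ i x, ‖(f i x : ℂ) - i‖ ≤ r) ∧
        ∀ x : Metric.closedBall (0 : ℂ) ρ,
          (fibre (perturb R₀ (diagonalSum d Q) δ) ((x : ℂ) : Sphere)).roots =
            Finset.univ.val.map fun i => (f i x : ℂ) := by
  have hR0 : R₀ ≠ 0 := by rintro rfl; simp at hR; omega
  have hr0 : 0 < ‖R₀.leadingCoeff‖ := norm_pos_iff.2 (leadingCoeff_ne_zero.2 hR0)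
  obtain ⟨Δ, hΔ, hlead⟩ := exists_natDegree_fibre_eq hd hR hQ
  obtain ⟨L, hL0, hL⟩ := exists_lipschitz_bound (diagonalSum d Q) ρ
  set ℓ := ‖R₀.leadingCoeff‖ / 2
  have hℓ : 0 < ℓ := half_pos hr0
  -- The second bound puts a root within r of each zero of R₀; the third gives the contraction
  -- factor 1/2.
  refine ⟨min Δ (min (ℓ * r ^ d / (L + 1)) (ℓ * (2 * r) ^ (d - 1) / 2 / (L + 1))),
    lt_min hΔ (lt_min (by positivity) (by positivity)), fun δ hδ => ?_⟩
  obtain ⟨hδ1, hδ2, hδ3⟩ : _ ∧ _ ∧ _ := by simpa only [lt_min_iff] using hδ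
  rw [lt_div_iff₀ (by positivity)] at hδ2 hδ3
  have hlead := hlead δ hδ1
  set p : ℂ → ℂ[X] := fun z => fibre (perturb R₀ (diagonalSum d Q) δ) (z : Sphere)
  have hpe : ∀ z w, (p z).eval w =
      R₀.eval w + δ * MvPolynomial.eval ![z, w] (diagonalSum d Q) := fun z w => by
    simp only [p]
    rw [fibre_perturb_coe, eval_add, eval_mul, eval_C, eval_fibre]
  have hnear : ∀ (u : R₀.roots.toFinset) (x : Metric.closedBall (0 : ℂ) ρ),
      ∃ w ∈ (p x).roots, ‖w - u‖ < r := by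
    intro u x
    apply exists_root_norm_sub_lt hr
    have hu : R₀.eval (u : ℂ) = 0 := isRoot_of_mem_roots (Multiset.mem_toFinset.1 u.2)
    have huρ : ‖(u : ℂ)‖ ≤ ρ := by have := hρ u u.2; linarith
    have hx := mem_closedBall_zero_iff.1 x.2
    rw [hpe, hu, zero_add, norm_mul, (hlead x).1]
    calc _ ≤ ‖δ‖ * L := by gcongr; exact (hL x x u hx hx huρ).1
      _ ≤ ‖δ‖ * (L + 1) := by gcongr; linarith
      _ < ℓ * r ^ d := hδ2
      _ ≤ _ := by gcongr; exact (hlead x).2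
  choose g hgroot hgr using hnear
  have hgρ : ∀ u x, ‖g u x‖ ≤ ρ := fun u x => by
    have h1 := hρ u u.2
    have h2 := norm_le_norm_sub_add (g u x) u
    have h3 := hgr u x
    linarith
  have hdist : ∀ u v : R₀.roots.toFinset, v ≠ u → ∀ x y, 2 * r ≤ ‖g u x - g v y‖ := by
    intro u v huv x y
    have h1 := hsep v v.2 u u.2 (fun h => huv (Subtype.ext h))
    have h2 := hgr u x
    have h3 := hgr v y
    have h4 : ‖(v : ℂ) - u‖ ≤ ‖g v y - v‖ + ‖g u x - g v y‖ + ‖g u x - u‖ := by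
      calc ‖(v : ℂ) - u‖ = ‖-(g v y - v) + -(g u x - g v y) + (g u x - u)‖ := by
            congr 1; ring
        _ ≤ _ := (norm_add₃_le).trans_eq (by rw [norm_neg, norm_neg])
    linarith
  have hroots : ∀ x : Metric.closedBall (0 : ℂ) ρ,
      (p x).roots = Finset.univ.val.map fun u => g u x := by
    intro x
    symm
    have hinj : Function.Injective fun u => g u x := by
      intro u v huv
      by_contra hne
      have := hdist u v (fun h => hne h.symm) x x
      rw [show g u x = g v x from huv, sub_self, norm_zero] at this
      linarith
    -- The d separated roots found near the zeros of R₀ exhaust a polynomial of degree d.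
    refine Multiset.eq_of_le_of_card_le ?_ ?_
    · rw [Multiset.le_iff_subset (Finset.univ.nodup.map hinj)]
      intro w hw
      obtain ⟨u, -, rfl⟩ := Multiset.mem_map.1 hw
      exact hgroot u x
    · rw [Multiset.card_map, Finset.card_val, Finset.card_univ, Fintype.card_coe, hcard,
        ← (IsAlgClosed.splits (p x)).natDegree_eq_card_roots, (hlead x).1]
  refine ⟨fun u x => ⟨g u x, mem_closedBall_zero_iff.2 (hgρ u x)⟩, fun u x y => ?_,
    fun u x => (hgr u x).le, hroots⟩
  have hx := mem_closedBall_zero_iff.1 x.2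
  have hy := mem_closedBall_zero_iff.1 y.2
  -- The polynomial over y is evaluated at a root of the polynomial over x: the value is of order
  -- |δ||x - y|, and so is the distance to the corresponding root over y.
  have h1 := norm_sub_mul_le_norm_eval (hroots y) (s := 2 * r) (by positivity) (w := g u x) u
    (fun v hv => hdist u v hv x y)
  have h2 : (p x).eval (g u x) = 0 := isRoot_of_mem_roots (hgroot u x)
  have h3 : ‖(p y).eval (g u x)‖ ≤ ‖δ‖ * (L * ‖(x : ℂ) - y‖) := by
    have : (p y).eval (g u x) = -(δ * (MvPolynomial.eval ![(x : ℂ), g u x] (diagonalSum d Q) -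
        MvPolynomial.eval ![(y : ℂ), g u x] (diagonalSum d Q))) := by
      rw [hpe] at h2
      rw [hpe]
      linear_combination h2
    rw [this, norm_neg, norm_mul]
    gcongr
    exact (hL x y _ hx hy (hgρ u x)).2
  rw [Fintype.card_coe, hcard] at h1
  rw [Subtype.dist_eq, Subtype.dist_eq, dist_eq_norm, dist_eq_norm]
  set T := ℓ * (2 * r) ^ (d - 1)
  have hT : 0 < T := by positivity
  refine le_of_mul_le_mul_left ?_ hT
  calc T * ‖g u x - g u y‖
      ≤ ‖(p y).leadingCoeff‖ * (2 * r) ^ (d - 1) * ‖g u x - g u y‖ := by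
        simp only [T]; gcongr; exact (hlead y).2
    _ ≤ ‖δ‖ * (L * ‖(x : ℂ) - y‖) := h1.trans h3
    _ = (‖δ‖ * L) * ‖(x : ℂ) - y‖ := by ring
    _ ≤ T / 2 * ‖(x : ℂ) - y‖ := by
      gcongr
      refine le_trans ?_ hδ3.le
      gcongr
      linarith
    _ = T * (2⁻¹ * ‖(x : ℂ) - y‖) := by ring

lemma exists_separation (s : Finset ℂ) :
    ∃ r : ℝ, 0 < r ∧ ∀ u ∈ s, ∀ v ∈ s, u ≠ v → 4 * r ≤ ‖u - v‖ := by
  have h : ∀ t ⊆ s.offDiag, ∃ r : ℝ, 0 < r ∧ ∀ q ∈ t, 4 * r ≤ ‖q.1 - q.2‖ := by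
    intro t
    induction t using Finset.induction_on with
    | empty => exact fun _ => ⟨1, one_pos, by simp⟩
    | insert q t _ ih =>
      intro hts
      obtain ⟨r, hr, h⟩ := ih ((Finset.subset_insert _ _).trans hts)
      have hq := Finset.mem_offDiag.1 (hts (Finset.mem_insert_self _ _))
      have hq' : 0 < ‖q.1 - q.2‖ := norm_pos_iff.2 (sub_ne_zero.2 hq.2.2)
      refine ⟨min r (‖q.1 - q.2‖ / 4), lt_min hr (by positivity), fun q' hq' => ?_⟩
      have h1 := min_le_left r (‖q.1 - q.2‖ / 4)
      have h2 := min_le_right r (‖q.1 - q.2‖ / 4)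
      rcases Finset.mem_insert.1 hq' with rfl | hq'
      · linarith
      · have := h q' hq'; linarith
  obtain ⟨r, hr, h⟩ := h _ subset_rfl
  exact ⟨r, hr, fun u hu v hv huv => h (u, v) (Finset.mem_offDiag.2 ⟨hu, hv, huv⟩)⟩

end Perturbation

/-! ### Choice of the disc and conclusion -/

section Perturbation

open Polynomial

variable {d : ℕ} {Q : ℕ → ℂ[X]} {R₀ : ℂ[X]}

lemma natDegree_fibre_infty_le (hR : R₀.natDegree = d) (hQ : ∀ i ≤ d, (Q i).natDegree ≤ i)
    {j : ℕ} (hjd : j < d) (hj : ∀ i < j, Q i = 0) (hjne : Q j ≠ 0) (δ : ℂ) :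
    (fibre (perturb R₀ (diagonalSum d Q) δ) OnePoint.infty).natDegree ≤ d := by
  rcases eq_or_ne δ 0 with rfl | hδ
  · rw [fibre_perturb_infty_zero, hR]
  · rw [fibre_perturb_diagonalSum_infty R₀ hjd hj hjne hδ]
    refine (natDegree_C_mul_le _ _).trans ?_
    rw [← C_1, ← C_neg, ← C_pow]
    exact (natDegree_C_mul_le _ _).trans ((hQ j hjd.le).trans hjd.le)

lemma coe_mem_images_infty {j : ℕ} (hjd : j < d) (hj : ∀ i < j, Q i = 0) (hjne : Q j ≠ 0)
    {δ : ℂ} (hδ : δ ≠ 0) {w : ℂ} (hw : (Q j).IsRoot w) :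
    (w : Sphere) ∈ images (perturb R₀ (diagonalSum d Q) δ) OnePoint.infty := by
  refine Multiset.mem_add.2 (Or.inl (Multiset.mem_map_of_mem _ ?_))
  rw [fibre_perturb_diagonalSum_infty R₀ hjd hj hjne hδ, mem_roots, IsRoot, eval_mul, eval_mul,
    hw.eq_zero, mul_zero, mul_zero]
  exact mul_ne_zero (C_ne_zero.2 hδ) (mul_ne_zero (pow_ne_zero _ (by simp)) hjne)

theorem exists_equilibriumMeasure_perturb (hR : R₀.natDegree = d)
    (hsimple : ∀ u : ℂ, R₀.IsRoot u → R₀.rootMultiplicity u = 1)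
    (hP : (diagonalSum d Q).totalDegree ≤ d) (hQ : ∀ i ≤ d, (Q i).natDegree ≤ i)
    {j : ℕ} (hjd : j < d) (hj : ∀ i < j, Q i = 0) (hjdeg : (Q j).natDegree ≠ 0)
    {ε : ℝ} (hε : 0 < ε) :
    ∃ Δ : ℝ, 0 < Δ ∧ ∀ δ : ℂ, ‖δ‖ < Δ →
      ∃ μ : Measure Sphere, IsProbabilityMeasure μ ∧ μ.Regular ∧
        pushforward (images (perturb R₀ (diagonalSum d Q) δ)) μ = (d : ENNReal) • μ ∧
        (∀ a : Sphere, WeakStarTendsto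
          (fun m => ((d : ENNReal) ^ m)⁻¹ •
            pushforward (iter (images (perturb R₀ (diagonalSum d Q) δ)) m)
              (Measure.dirac a)) μ) ∧
        μ.support ⊆ (fun w : ℂ => (w : Sphere)) '' Metric.thickening ε {u : ℂ | R₀.IsRoot u} ∧
        IsLeast {S : Set Sphere | S.Nonempty ∧ IsClosed S ∧
          ForwardInvariant (perturb R₀ (diagonalSum d Q) δ) S} μ.support := by
  have hd : 0 < d := by omega
  have hR0 : R₀ ≠ 0 := by rintro rfl; simp at hR; omega
  have hjne : Q j ≠ 0 := by rintro h; simp [h] at hjdeg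
  have hcardU : R₀.roots.toFinset.card = d := (card_roots_toFinset hsimple).trans hR
  obtain ⟨w₀, hw₀⟩ := IsAlgClosed.exists_root (Q j)
    (fun h => hjdeg (natDegree_eq_of_degree_eq_some h))
  obtain ⟨r₀, hr₀, hsep⟩ := exists_separation R₀.roots.toFinset
  obtain ⟨ρ₀, M, Δ₁, hΔ₁, hsmall⟩ := exists_small_root_of_le_norm hR hQ hjd hj hjdeg
  obtain ⟨Δ₂, hΔ₂, hlead⟩ := exists_natDegree_fibre_eq hd hR hQ
  set r := min r₀ (ε / 2)
  have hr : 0 < r := lt_min hr₀ (half_pos hε)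
  have hrr₀ : r ≤ r₀ := min_le_left _ _
  have hrε : r < ε := (min_le_right _ _).trans_lt (half_lt_self hε)
  -- The disc must contain the r-discs about the zeros of R₀ in its interior, the small roots of
  -- distant fibres, and the zero `w₀` of Q_j. Since ρ exceeds `M`, every z outside the disc counts
  -- as distant.
  set ρ := ∑ u ∈ R₀.roots.toFinset, ‖u‖ + r + 1 + |ρ₀| + |M| + ‖w₀‖
  have hsum : 0 ≤ ∑ u ∈ R₀.roots.toFinset, ‖u‖ := Finset.sum_nonneg fun _ _ => norm_nonneg _
  have hρ₀ := le_abs_self ρ₀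
  have hM := le_abs_self M
  have hρ₀' := abs_nonneg ρ₀
  have hM' := abs_nonneg M
  have hw₀' := norm_nonneg w₀
  have hU : ∀ u ∈ R₀.roots.toFinset, ‖u‖ + r < ρ := fun u hu => by
    have := Finset.single_le_sum (f := fun u : ℂ => ‖u‖) (fun _ _ => norm_nonneg _) hu
    simp only [ρ]
    linarith
  obtain ⟨Δ₃, hΔ₃, hbranch⟩ := exists_branches hd hR hcardU hQ hr
    (fun u hu v hv huv => (by linarith : 4 * r ≤ 4 * r₀).trans (hsep u hu v hv huv))
    (fun u hu => (hU u hu).le)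
  refine ⟨min Δ₁ (min Δ₂ Δ₃), lt_min hΔ₁ (lt_min hΔ₂ hΔ₃), fun δ hδ => ?_⟩
  obtain ⟨hδ₁, hδ₂, hδ₃⟩ : _ ∧ _ ∧ _ := by simpa only [lt_min_iff] using hδ
  obtain ⟨f, hf, hfr, hroots⟩ := hbranch δ hδ₃
  have hlead := hlead δ hδ₂
  have hsmall := hsmall δ hδ₁
  set R := perturb R₀ (diagonalSum d Q) δ
  have hdegR : MvPolynomial.degreeOf 1 R = d :=
    -- The lower bound is read off from the fibre over z = 0.
    le_antisymm (degreeOf_perturb_le hR.le hP δ) ((hlead 0).1 ▸ natDegree_fibre_le R 0)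
  have himages : ∀ z : ℂ, images R (z : Sphere) =
      (fibre R (z : Sphere)).roots.map fun w : ℂ => (w : Sphere) := fun z =>
    images_coe_eq R z ((hlead z).1.trans hdegR.symm)
  have hcardι : Fintype.card R₀.roots.toFinset = d := (Fintype.card_coe _).trans hcardU
  have hι : Nonempty R₀.roots.toFinset := Fintype.card_pos_iff.1 (hcardι ▸ hd)
  obtain ⟨u₀⟩ := id hι
  have hmem : ∀ a : Sphere, ∀ w : ℂ, ‖w‖ ≤ ρ → (w : Sphere) ∈ images R a →
      ∃ x, discIncl ρ x ∈ images R a := fun a w hw h => ⟨⟨w, mem_closedBall_zero_iff.2 hw⟩, h⟩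
  have hF : ∀ x, images R (discIncl ρ x) = Finset.univ.val.map fun i => discIncl ρ (f i x) := by
    intro x
    change images R ((x : ℂ) : Sphere) = _
    rw [himages, hroots, Multiset.map_map]
    rfl
  have hcard : ∀ a, (images R a).card = Fintype.card R₀.roots.toFinset := by
    intro a
    rw [hcardι, ← hdegR]
    refine card_images R a ?_
    rw [hdegR]
    induction a using OnePoint.rec with
    | infty => exact natDegree_fibre_infty_le hR hQ hjd hj hjne δ
    | coe z => exact (hlead z).1.le
  have hret : ∀ a, ∃ x, discIncl ρ x ∈ images R a := by
    intro a
    induction a using OnePoint.rec with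
    | infty =>
      rcases eq_or_ne δ 0 with hδ0 | hδ0
      · refine hmem _ u₀ (by have := hU u₀ u₀.2; linarith) ?_
        refine Multiset.mem_add.2 (Or.inl (Multiset.mem_map_of_mem _ ?_))
        simp only [R, hδ0]
        rw [fibre_perturb_infty_zero]
        exact Multiset.mem_toFinset.1 u₀.2
      · exact hmem _ w₀ (by simp only [ρ]; linarith) (coe_mem_images_infty hjd hj hjne hδ0 hw₀)
    | coe z =>
      rcases le_total ‖z‖ ρ with hz | hz
      · refine ⟨f u₀ ⟨z, mem_closedBall_zero_iff.2 hz⟩, ?_⟩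
        rw [himages, hroots ⟨z, mem_closedBall_zero_iff.2 hz⟩, Multiset.map_map]
        exact Multiset.mem_map_of_mem (fun i => discIncl ρ (f i _)) (Finset.mem_univ_val u₀)
      · obtain ⟨w, hw, hwρ⟩ := hsmall z (le_trans (by simp only [ρ]; linarith) hz)
        refine hmem _ w (by simp only [ρ]; linarith) ?_
        rw [himages]
        exact Multiset.mem_map_of_mem _ hw
  have hfin : ∀ (z : ℂ) (b : Sphere), b ∈ images R (z : Sphere) ↔
      ∃ w : ℂ, b = w ∧ MvPolynomial.eval ![z, w] R = 0 := by
    intro z b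
    have hne : fibre R (z : Sphere) ≠ 0 := fun h => by
      have := (hlead z).1
      rw [h, natDegree_zero] at this
      omega
    rw [himages, Multiset.mem_map]
    simp only [mem_roots hne, IsRoot, eval_fibre]
    exact ⟨fun ⟨w, h, hb⟩ => ⟨w, hb.symm, h⟩, fun ⟨w, hb, h⟩ => ⟨w, h, hb.symm⟩⟩
  have hCρ : ∀ w ∈ ⋃ u ∈ R₀.roots.toFinset, Metric.closedBall u r, ‖w‖ < ρ := by
    intro w hw
    obtain ⟨u, hu, hw⟩ := Set.mem_iUnion₂.1 hw
    have h1 := hU u hu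
    have h2 := norm_le_norm_sub_add w u
    rw [Metric.mem_closedBall, dist_eq_norm] at hw
    linarith
  have hfC : ∀ i x, (f i x : ℂ) ∈ ⋃ u ∈ R₀.roots.toFinset, Metric.closedBall u r := by
    intro i x
    refine Set.mem_iUnion₂.2 ⟨i, i.2, ?_⟩
    rw [Metric.mem_closedBall, dist_eq_norm]
    exact hfr i x
  obtain ⟨μ, h1, h2, h3, h4, h5, h6⟩ := exists_equilibriumMeasure R (ρ := ρ)
    (by positivity) hf hF hcard hret hfin
    (R₀.roots.toFinset.finite_toSet.isClosed_biUnion fun _ _ => Metric.isClosed_closedBall) hCρ hfC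
  rw [hcardι] at h3 h4
  refine ⟨μ, h1, h2, h3, h4, h5.trans (Set.image_mono ?_), h6⟩
  refine Set.iUnion₂_subset fun u hu w hw => ?_
  exact Metric.mem_thickening_iff.2 ⟨u, isRoot_of_mem_roots (Multiset.mem_toFinset.1 hu),
    (Metric.mem_closedBall.1 hw).trans_lt hrε⟩

end Perturbation

end HolCorr

end

theorem mainTheorem3 (d : ℕ) (R₀ : Polynomial ℂ) (hdeg : R₀.natDegree = d)
    (hsimple : ∀ u : ℂ, R₀.IsRoot u → R₀.rootMultiplicity u = 1)
    (P : MvPolynomial (Fin 2) ℂ) (hP : P.totalDegree ≤ d)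
    (Q : ℕ → Polynomial ℂ) (hQdeg : ∀ i ≤ d, (Q i).natDegree ≤ i)
    (hPQ : P = ∑ i ∈ Finset.range (d + 1),
      Polynomial.aeval (MvPolynomial.X 1) (Q i) *
        (MvPolynomial.X 1 - MvPolynomial.X 0) ^ (d - i))
    (j : ℕ) (hj : j < d) (hjne : Q j ≠ 0) (hjmin : ∀ i < j, Q i = 0)
    (hjconst : ¬ ∃ c : ℂ, Q j = Polynomial.C c)
    (ε : ℝ) (hε : 0 < ε) :
    ∃ Δ : ℝ, 0 < Δ ∧ ∀ δ : ℂ, ‖δ‖ < Δ →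
      ∃ μ : MeasureTheory.Measure HolCorr.Sphere, MeasureTheory.IsProbabilityMeasure μ ∧ μ.Regular ∧
        HolCorr.pushforward (HolCorr.images (HolCorr.perturb R₀ P δ)) μ = (d : ENNReal) • μ ∧
        (∀ a : HolCorr.Sphere, HolCorr.WeakStarTendsto
          (fun m => ((d : ENNReal) ^ m)⁻¹ •
            HolCorr.pushforward (HolCorr.iter (HolCorr.images (HolCorr.perturb R₀ P δ)) m)
              (MeasureTheory.Measure.dirac a)) μ) ∧
        μ.support ⊆ (fun w : ℂ => (w : HolCorr.Sphere)) ''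
          Metric.thickening ε {u : ℂ | R₀.IsRoot u} ∧
        IsLeast {S : Set HolCorr.Sphere | S.Nonempty ∧ IsClosed S ∧
          HolCorr.ForwardInvariant (HolCorr.perturb R₀ P δ) S} μ.support := by
  subst hPQ
  exact HolCorr.exists_equilibriumMeasure_perturb hdeg hsimple hP hQdeg hj hjmin
    (fun h => hjconst ⟨_, Polynomial.eq_C_of_natDegree_eq_zero h⟩) hε
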